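/- Let $L$ be a signature with countably many relation symbols and function symbols, each with an arity $n\ge 0$ (function symbols of arity $0$ are constants). **Second-order logic (SOL).** There are countably many individual variables and, for each $n\ge 0$, countably many $n$-ary predicate variables, all these sets being pairwise disjoint. $\mathrm{SOL}$-formulas over $L$ are built from $\bot$, $R(t_1,\dots,t_n)$ and $X^n(t_1,\dots,t_n)$ (with $R\in L$ an $n$-ary relation symbol, $X^n$ an $n$-ary predicate variable, and $t_k$ first-order $L$-terms) by $\land,\lor,\to$ and the quantifiers $\forall x,\exists x,\forall X^n,\exists X^n$; equality is not primitive. A second-order term of arity $n$ is an $n$-ary predicate variable, an $n$-ary relation symbol of $L$ or, if $n=0$, also $\bot$. Sentences are formulas without free variables of either kind. $\Gamma\vdash_{\mathrm{SOL}}\varphi$ means that $\varphi$ is derivable from $\Gamma$ in classical natural deduction (the usual introduction and elimination rules for $\land,\lor,\to,\forall x,\exists x$, ex falso, and reductio ad absurdum), with the analogous rules for $\forall X^n$ and $\exists X^n$ (instantiated by second-order terms $T^n$ free for $X^n$), and with the universal closures of all instances of comprehension $$\exists X^n\forall x_1\cdots\forall x_n\,(X^n(x_1,\dots,x_n)\leftrightarrow\psi),\qquad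 X^n \text{ not free in }\psi,$$ as axioms. **First-order logic (FOL).** $\vdash_{\mathrm{FOL}}$ is derivability in classical unsorted first-order natural deduction with the usual axioms of equality (reflexivity, symmetry, transitivity, and congruence for all relation and function symbols). The signature is $L^\dagger$, consisting of the function symbols of $L$, a new constant $c_R$ for each relation symbol $R\in L$, a new constant $c_\bot$, an $(n+1)$-ary relation symbol $Ap_n$ for each $n\ge0$, and unary relation symbols $V$ and $U_n$ for each $n\ge 0$. All the individual and predicate variables of SOL together serve as the variables. **Translation.** To each $\mathrm{SOL}$-formula $\varphi$ over $L$ associate the $L^\dagger$-formula $\varphi^\dagger$ given by - $\bot^\dagger:=Ap_0(c_\bot)$; - $(X^n(t_1,\dots,t_n))^\dagger:=Ap_n(X,t_1,\dots,t_n)$ and $(R(t_1,\dots,t_n))^\dagger:=Ap_n(c_R,t_1,\dots,t_n)$; - $(\varphi\star\psi)^\dagger:=\varphi^\dagger\star\psi^\dagger$ for $\star\in\{\land,\lor,\to\}$; - $(\forall x\,\varphi)^\dagger:=\forall x(V(x)\to\varphi^\dagger)$ and $(\exists x\,\varphi)^\dagger:=\exists x(V(x)\land\varphi^\dagger)$;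 - $(\forall X^n\varphi)^\dagger:=\forall X(U_n(X)\to\varphi^\dagger)$ and $(\exists X^n\varphi)^\dagger:=\exists X(U_n(X)\land\varphi^\dagger)$. Let $G$ be the set of the universal closures of the following formulas: - $\exists x\,V(x)$, and $\exists x\,U_n(x)$ for each $n\ge 0$; - $V(x)\to\neg U_n(x)$ for each $n\ge0$, and $U_m(x)\to\neg U_n(x)$ for $m\ne n$; - $Ap_n(x,y_1,\dots,y_n)\to U_n(x)\land\bigwedge_{k=1}^nV(y_k)$ for each $n\ge 0$; - $V(c)$ for each constant $c\in L$, and $U_n(c_R)$ for each $n$-ary relation symbol $R\in L$; - $U_0(c_\bot)$ and $\neg Ap_0(c_\bot)$; - $V(x_1)\land\dots\land V(x_n)\to V(f(x_1,\dots,x_n))$ for each $n$-ary function symbol $f\in L$; - $\psi^\dagger$, for each universal closure $\psi$ of an instance of the comprehension schema. **Theorem.** If $\Gamma\cup\{\varphi\}$ is a set of $\mathrm{SOL}$-sentences over $L$, then $$\Gamma\vdash_{\mathrm{SOL}}\varphi\quad\text{if and only if}\quad\Gamma^\dagger,G\vdash_{\mathrm{FOL}}\varphi^\dagger,$$ where $\Gamma^\dagger:=\{\psi^\dagger:\psi\in\Gamma\}$.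 -/

import Mathlib

namespace VanDalen

universe u

/-! ## Unsorted signatures and first-order terms -/

/-- An unsorted signature: countably many relation symbols and function symbols, each with an
arity `n ≥ 0`.  Function symbols of arity `0` are the constants. -/
structure Signature where
  Rel : Type u
  Fun : Type u
  relArity : Rel → ℕ
  funArity : Fun → ℕ
  countable_rel : Countable Rel
  countable_fun : Countable Fun

/-- `L`-terms over the pool of variables `V`. -/
inductive Term (L : Signature.{u}) (V : Type) : Type u
  | var (x : V) : Term L V
  | app (f : L.Fun) (ts : Fin (L.funArity f) → Term L V) : Term L V

namespace Term

variable {L : Signature.{u}} {V : Type}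

/-- The variables occurring in a term. -/
def vars : Term L V → Set V
  | var x => {x}
  | app _ ts => ⋃ i, (ts i).vars

/-- `s.subst x t` is `s[t/x]`. -/
def subst [DecidableEq V] (s : Term L V) (x : V) (t : Term L V) : Term L V :=
  match s with
  | var y => if y = x then t else var y
  | app f ts => app f (fun i => (ts i).subst x t)

end Term

/-! ## First-order logic with equality -/

/-- First-order `L`-formulas with equality over the pool of variables `V`. -/
inductive Formula (L : Signature.{u}) (V : Type) : Type u
  | bot : Formula L V
  | eq (s t : Term L V) : Formula L V
  | rel (R : L.Rel) (ts : Fin (L.relArity R) → Term L V) : Formula L V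
  | and (A B : Formula L V) : Formula L V
  | or (A B : Formula L V) : Formula L V
  | imp (A B : Formula L V) : Formula L V
  | all (x : V) (A : Formula L V) : Formula L V
  | ex (x : V) (A : Formula L V) : Formula L V

namespace Formula

variable {L : Signature.{u}} {V : Type}

/-- `¬ A` is `A → ⊥`. -/
def neg (A : Formula L V) : Formula L V := imp A bot

/-- `⊤` is `⊥ → ⊥`. -/
def top : Formula L V := imp bot bot

/-- `A₁ ∧ ⋯ ∧ Aₙ`; the empty conjunction is `⊤`. -/
def conj : List (Formula L V) → Formula L V
  | [] => top
  | [A] => A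
  | A :: B :: l => and A (conj (B :: l))

/-- The free variables of a formula. -/
def fv : Formula L V → Set V
  | bot => ∅
  | eq s t => s.vars ∪ t.vars
  | rel _ ts => ⋃ i, (ts i).vars
  | and A B => A.fv ∪ B.fv
  | or A B => A.fv ∪ B.fv
  | imp A B => A.fv ∪ B.fv
  | all x A => A.fv \ {x}
  | ex x A => A.fv \ {x}

/-- `A.subst x t` replaces each free occurrence of `x` in `A` by `t` (no renaming of bound
variables; it is only used when `t` is free for `x` in `A`). -/
def subst [DecidableEq V] (x : V) (t : Term L V) : Formula L V → Formula L V
  | bot => bot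
  | eq r s => eq (r.subst x t) (s.subst x t)
  | rel R ts => rel R (fun i => (ts i).subst x t)
  | and A B => and (A.subst x t) (B.subst x t)
  | or A B => or (A.subst x t) (B.subst x t)
  | imp A B => imp (A.subst x t) (B.subst x t)
  | all y A => if y = x then all y A else all y (A.subst x t)
  | ex y A => if y = x then ex y A else ex y (A.subst x t)

/-- `t` is free for `x` in `A`: no free occurrence of `x` in `A` lies in the scope of a quantifier
binding a variable of `t`. -/
def FreeFor (x : V) (t : Term L V) : Formula L V → Prop
  | bot => True
  | eq _ _ => True
  | rel _ _ => True
  | and A B => A.FreeFor x t ∧ B.FreeFor x t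
  | or A B => A.FreeFor x t ∧ B.FreeFor x t
  | imp A B => A.FreeFor x t ∧ B.FreeFor x t
  | all y A => x ∉ (all y A).fv ∨ (y ∉ t.vars ∧ A.FreeFor x t)
  | ex y A => x ∉ (ex y A).fv ∨ (y ∉ t.vars ∧ A.FreeFor x t)

/-- `∀ x₁ ⋯ ∀ xₙ A`. -/
def allList (xs : List V) (A : Formula L V) : Formula L V := xs.foldr all A

/-- `B` is a universal closure of `A`: it is `∀ x₁ ⋯ ∀ xₙ A`, where `x₁, …, xₙ` enumerate the free
variables of `A` without repetition (in any order). -/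
def IsUnivClosure (A B : Formula L V) : Prop :=
  ∃ xs : List V, xs.Nodup ∧ (∀ x, x ∈ xs ↔ x ∈ A.fv) ∧ B = allList xs A

end Formula

/-- The equality axioms (before taking universal closures). -/
inductive EqAxiom {L : Signature.{u}} {V : Type} : Formula L V → Prop
  | refl (x : V) : EqAxiom (.eq (.var x) (.var x))
  | symm (x y : V) : EqAxiom (.imp (.eq (.var x) (.var y)) (.eq (.var y) (.var x)))
  | trans (x y z : V) :
      EqAxiom (.imp (.and (.eq (.var x) (.var y)) (.eq (.var y) (.var z)))
        (.eq (.var x) (.var z)))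
  | relCongr (R : L.Rel) (x y : Fin (L.relArity R) → V) :
      EqAxiom (.imp (.conj (List.ofFn fun k => .eq (.var (x k)) (.var (y k))))
        (.imp (.rel R fun k => .var (x k)) (.rel R fun k => .var (y k))))
  | funCongr (f : L.Fun) (x y : Fin (L.funArity f) → V) :
      EqAxiom (.imp (.conj (List.ofFn fun k => .eq (.var (x k)) (.var (y k))))
        (.eq (.app f fun k => .var (x k)) (.app f fun k => .var (y k))))

/-- `FOL Γ A` is `Γ ⊢_FOL A`: there is a natural deduction derivation of `A`, possibly using
universal closures of equality axioms, all of whose undischarged assumptions belong to `Γ`.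
(The rule `weaken` says that `Γ` need not consist of assumptions that are really used, so that the
conditions on the eigenvariables only concern the undischarged assumptions.) -/
inductive FOL {L : Signature.{u}} {V : Type} [DecidableEq V] :
    Set (Formula L V) → Formula L V → Prop
  | assume {Γ A} (h : A ∈ Γ) : FOL Γ A
  | weaken {Γ Δ A} (h : Δ ⊆ Γ) (d : FOL Δ A) : FOL Γ A
  | eqAx {Γ A B} (h : EqAxiom A) (hB : A.IsUnivClosure B) : FOL Γ B
  | andI {Γ A B} (d : FOL Γ A) (e : FOL Γ B) : FOL Γ (.and A B)
  | andE₁ {Γ A B} (d : FOL Γ (.and A B)) : FOL Γ A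
  | andE₂ {Γ A B} (d : FOL Γ (.and A B)) : FOL Γ B
  | orI₁ {Γ A B} (d : FOL Γ A) : FOL Γ (.or A B)
  | orI₂ {Γ A B} (d : FOL Γ B) : FOL Γ (.or A B)
  | orE {Γ A B C} (d : FOL Γ (.or A B)) (e₁ : FOL (insert A Γ) C) (e₂ : FOL (insert B Γ) C) :
      FOL Γ C
  | impI {Γ A B} (d : FOL (insert A Γ) B) : FOL Γ (.imp A B)
  | impE {Γ A B} (d : FOL Γ (.imp A B)) (e : FOL Γ A) : FOL Γ B
  | botE {Γ A} (d : FOL Γ .bot) : FOL Γ A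
  | raa {Γ A} (d : FOL (insert A.neg Γ) .bot) : FOL Γ A
  | allI {Γ A x} (hx : ∀ B ∈ Γ, x ∉ B.fv) (d : FOL Γ A) : FOL Γ (.all x A)
  | allE {Γ A x t} (ht : A.FreeFor x t) (d : FOL Γ (.all x A)) : FOL Γ (A.subst x t)
  | exI {Γ A x t} (ht : A.FreeFor x t) (d : FOL Γ (A.subst x t)) : FOL Γ (.ex x A)
  | exE {Γ Δ A C x} (hΔ : Δ ⊆ Γ) (hx : ∀ B ∈ Δ, x ∉ B.fv) (hC : x ∉ C.fv)
      (d : FOL Γ (.ex x A)) (e : FOL (insert A Δ) C) : FOL Γ C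

/-! ## Second-order logic -/

/-- The variables of second-order logic: the individual variables (`ind k`), and for each `n` the
`n`-ary predicate variables (`pred n k`). -/
inductive SOVar : Type
  | ind (k : ℕ) : SOVar
  | pred (n k : ℕ) : SOVar
  deriving DecidableEq

/-- Second-order `L`-formulas.  There is no primitive equality.  The `L`-terms are the first-order
ones over the individual variables.  `pvar n X ts` is `Xⁿ(t₁, …, tₙ)`; the quantifiers `all v`,
`ex v` are first-order if `v = ind x` and second-order if `v = pred n X`. -/
inductive SOFormula (L : Signature.{u}) : Type u
  | bot : SOFormula L
  | rel (R : L.Rel) (ts : Fin (L.relArity R) → Term L ℕ) : SOFormula L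
  | pvar (n X : ℕ) (ts : Fin n → Term L ℕ) : SOFormula L
  | and (A B : SOFormula L) : SOFormula L
  | or (A B : SOFormula L) : SOFormula L
  | imp (A B : SOFormula L) : SOFormula L
  | all (v : SOVar) (A : SOFormula L) : SOFormula L
  | ex (v : SOVar) (A : SOFormula L) : SOFormula L

/-- Second-order terms of arity `n`: the `n`-ary predicate variables, the `n`-ary relation symbols
and, for `n = 0`, also `⊥`. -/
inductive SOTerm (L : Signature.{u}) : ℕ → Type u
  | pvar (n X : ℕ) : SOTerm L n
  | rel (R : L.Rel) : SOTerm L (L.relArity R)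
  | bot : SOTerm L 0

namespace SOTerm

variable {L : Signature.{u}}

/-- The atomic formula `T(t₁, …, tₙ)`. -/
def atom : {n : ℕ} → SOTerm L n → (Fin n → Term L ℕ) → SOFormula L
  | _, pvar n X, ts => .pvar n X ts
  | _, rel R, ts => .rel R ts
  | _, bot, _ => .bot

/-- The variables (zero or one) occurring in a second-order term. -/
def vars : {n : ℕ} → SOTerm L n → Set SOVar
  | _, pvar n X => {.pred n X}
  | _, rel _ => ∅
  | _, bot => ∅

end SOTerm

namespace SOFormula

variable {L : Signature.{u}}

/-- `¬ A` is `A → ⊥`. -/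
def neg (A : SOFormula L) : SOFormula L := imp A bot

/-- `A ↔ B` is `(A → B) ∧ (B → A)`. -/
def iff (A B : SOFormula L) : SOFormula L := and (imp A B) (imp B A)

/-- The free (individual and predicate) variables of a formula. -/
def fv : SOFormula L → Set SOVar
  | bot => ∅
  | rel _ ts => ⋃ i, SOVar.ind '' (ts i).vars
  | pvar n X ts => {SOVar.pred n X} ∪ ⋃ i, SOVar.ind '' (ts i).vars
  | and A B => A.fv ∪ B.fv
  | or A B => A.fv ∪ B.fv
  | imp A B => A.fv ∪ B.fv
  | all v A => A.fv \ {v}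
  | ex v A => A.fv \ {v}

/-- A sentence is a formula without free variables of either kind. -/
def IsSentence (A : SOFormula L) : Prop := A.fv = ∅

/-- `A.subst x t` is `A[t/x]` for an individual variable `x` and a first-order term `t`. -/
def subst (x : ℕ) (t : Term L ℕ) : SOFormula L → SOFormula L
  | bot => bot
  | rel R ts => rel R (fun i => (ts i).subst x t)
  | pvar n X ts => pvar n X (fun i => (ts i).subst x t)
  | and A B => and (A.subst x t) (B.subst x t)
  | or A B => or (A.subst x t) (B.subst x t)
  | imp A B => imp (A.subst x t) (B.subst x t)
  | all v A => if v = .ind x then all v A else all v (A.subst x t)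
  | ex v A => if v = .ind x then ex v A else ex v (A.subst x t)

/-- `t` is free for the individual variable `x` in `A`. -/
def FreeFor (x : ℕ) (t : Term L ℕ) : SOFormula L → Prop
  | bot => True
  | rel _ _ => True
  | pvar _ _ _ => True
  | and A B => A.FreeFor x t ∧ B.FreeFor x t
  | or A B => A.FreeFor x t ∧ B.FreeFor x t
  | imp A B => A.FreeFor x t ∧ B.FreeFor x t
  | all v A => .ind x ∉ (all v A).fv ∨ (v ∉ SOVar.ind '' t.vars ∧ A.FreeFor x t)
  | ex v A => .ind x ∉ (ex v A).fv ∨ (v ∉ SOVar.ind '' t.vars ∧ A.FreeFor x t)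

/-- `A.subst₂ n X T` is `A[Tⁿ/Xⁿ]`: every free atomic formula `Xⁿ(t₁, …, tₙ)` is replaced by
`Tⁿ(t₁, …, tₙ)`. -/
def subst₂ (n X : ℕ) (T : SOTerm L n) : SOFormula L → SOFormula L
  | bot => bot
  | rel R ts => rel R ts
  | pvar m Y ts =>
      if h : m = n ∧ Y = X then T.atom (fun i => ts (Fin.cast h.1.symm i)) else pvar m Y ts
  | and A B => and (A.subst₂ n X T) (B.subst₂ n X T)
  | or A B => or (A.subst₂ n X T) (B.subst₂ n X T)
  | imp A B => imp (A.subst₂ n X T) (B.subst₂ n X T)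
  | all v A => if v = .pred n X then all v A else all v (A.subst₂ n X T)
  | ex v A => if v = .pred n X then ex v A else ex v (A.subst₂ n X T)

/-- `Tⁿ` is free for the predicate variable `Xⁿ` in `A`. -/
def FreeFor₂ (n X : ℕ) (T : SOTerm L n) : SOFormula L → Prop
  | bot => True
  | rel _ _ => True
  | pvar _ _ _ => True
  | and A B => A.FreeFor₂ n X T ∧ B.FreeFor₂ n X T
  | or A B => A.FreeFor₂ n X T ∧ B.FreeFor₂ n X T
  | imp A B => A.FreeFor₂ n X T ∧ B.FreeFor₂ n X T
  | all v A => .pred n X ∉ (all v A).fv ∨ (v ∉ T.vars ∧ A.FreeFor₂ n X T)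
  | ex v A => .pred n X ∉ (ex v A).fv ∨ (v ∉ T.vars ∧ A.FreeFor₂ n X T)

/-- `∀ v₁ ⋯ ∀ vₙ A`. -/
def allList (vs : List SOVar) (A : SOFormula L) : SOFormula L := vs.foldr all A

/-- `B` is a universal closure of `A`: it is `∀ v₁ ⋯ ∀ vₙ A`, where `v₁, …, vₙ` enumerate the free
variables (of both kinds) of `A` without repetition (in any order). -/
def IsUnivClosure (A B : SOFormula L) : Prop :=
  ∃ vs : List SOVar, vs.Nodup ∧ (∀ v, v ∈ vs ↔ v ∈ A.fv) ∧ B = allList vs A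

/-- The formula `∃ Xⁿ ∀ x₁ ⋯ ∀ xₙ (Xⁿ(x₁, …, xₙ) ↔ ψ)`. -/
def comprehension (n X : ℕ) (x : Fin n → ℕ) (ψ : SOFormula L) : SOFormula L :=
  ex (.pred n X)
    (allList (List.ofFn fun k => .ind (x k)) (iff (pvar n X fun k => .var (x k)) ψ))

end SOFormula

/-- The sentences that are (universal closures of) instances of the comprehension schema
`∃ Xⁿ ∀ x₁ ⋯ ∀ xₙ (Xⁿ(x₁, …, xₙ) ↔ ψ)`, where `x₁, …, xₙ` are distinct individual variables and
`Xⁿ` is not free in `ψ`. -/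
def Comprehension (L : Signature.{u}) : Set (SOFormula L) :=
  {B | ∃ (n X : ℕ) (x : Fin n → ℕ) (ψ : SOFormula L), Function.Injective x ∧
    SOVar.pred n X ∉ ψ.fv ∧ (SOFormula.comprehension n X x ψ).IsUnivClosure B}

/-- `SOL Γ A` is `Γ ⊢_SOL A`: there is a natural deduction derivation of `A`, possibly using
comprehension axioms, all of whose undischarged assumptions belong to `Γ`.
The rules `allI` and `exE` are the first-order or the second-order ones according to the kind of
the quantified variable. -/
inductive SOL {L : Signature.{u}} : Set (SOFormula L) → SOFormula L → Prop
  | assume {Γ A} (h : A ∈ Γ) : SOL Γ A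
  | weaken {Γ Δ A} (h : Δ ⊆ Γ) (d : SOL Δ A) : SOL Γ A
  | compr {Γ A} (h : A ∈ Comprehension L) : SOL Γ A
  | andI {Γ A B} (d : SOL Γ A) (e : SOL Γ B) : SOL Γ (.and A B)
  | andE₁ {Γ A B} (d : SOL Γ (.and A B)) : SOL Γ A
  | andE₂ {Γ A B} (d : SOL Γ (.and A B)) : SOL Γ B
  | orI₁ {Γ A B} (d : SOL Γ A) : SOL Γ (.or A B)
  | orI₂ {Γ A B} (d : SOL Γ B) : SOL Γ (.or A B)
  | orE {Γ A B C} (d : SOL Γ (.or A B)) (e₁ : SOL (insert A Γ) C) (e₂ : SOL (insert B Γ) C) :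
      SOL Γ C
  | impI {Γ A B} (d : SOL (insert A Γ) B) : SOL Γ (.imp A B)
  | impE {Γ A B} (d : SOL Γ (.imp A B)) (e : SOL Γ A) : SOL Γ B
  | botE {Γ A} (d : SOL Γ .bot) : SOL Γ A
  | raa {Γ A} (d : SOL (insert A.neg Γ) .bot) : SOL Γ A
  | allI {Γ A v} (hv : ∀ B ∈ Γ, v ∉ B.fv) (d : SOL Γ A) : SOL Γ (.all v A)
  | allE {Γ A x t} (ht : A.FreeFor x t) (d : SOL Γ (.all (.ind x) A)) : SOL Γ (A.subst x t)
  | exI {Γ A x t} (ht : A.FreeFor x t) (d : SOL Γ (A.subst x t)) : SOL Γ (.ex (.ind x) A)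
  | allE₂ {Γ A n X T} (hT : A.FreeFor₂ n X T) (d : SOL Γ (.all (.pred n X) A)) :
      SOL Γ (A.subst₂ n X T)
  | exI₂ {Γ A n X T} (hT : A.FreeFor₂ n X T) (d : SOL Γ (A.subst₂ n X T)) :
      SOL Γ (.ex (.pred n X) A)
  | exE {Γ Δ A C v} (hΔ : Δ ⊆ Γ) (hv : ∀ B ∈ Δ, v ∉ B.fv) (hC : v ∉ C.fv)
      (d : SOL Γ (.ex v A)) (e : SOL (insert A Δ) C) : SOL Γ C

/-! ## The translation into first-order logic -/

/-- The function symbols of the target signature: those of `L`, a constant `c_R` for each relation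
symbol `R` of `L`, and a constant `c_⊥`. -/
inductive DaggerFun (L : Signature.{u}) : Type u
  | fn (f : L.Fun) : DaggerFun L
  | cRel (R : L.Rel) : DaggerFun L
  | cBot : DaggerFun L

/-- The relation symbols of the target signature: `Apₙ`, `V` and `Uₙ`. -/
inductive DaggerRel : Type u
  | Ap (n : ℕ) : DaggerRel
  | V : DaggerRel
  | U (n : ℕ) : DaggerRel

/-- The target signature. -/
def Signature.dagger (L : Signature.{u}) : Signature.{u} where
  Rel := DaggerRel.{u}
  Fun := DaggerFun L
  relArity
    | .Ap n => n + 1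
    | .V => 1
    | .U _ => 1
  funArity
    | .fn f => L.funArity f
    | .cRel _ => 0
    | .cBot => 0
  countable_rel := by
    have h : Function.Injective (fun r : DaggerRel.{u} =>
        (match r with
          | .Ap n => Sum.inl n
          | .V => Sum.inr none
          | .U n => Sum.inr (some n) : ℕ ⊕ Option ℕ)) := by
      intro a b hab
      cases a <;> cases b <;> simp_all
    exact h.countable
  countable_fun := by
    have := L.countable_rel
    have := L.countable_fun
    have h : Function.Injective (fun r : DaggerFun L =>
        (match r with
          | .fn f => Sum.inl f
          | .cRel R => Sum.inr (some R)
          | .cBot => Sum.inr none : L.Fun ⊕ Option L.Rel)) := by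
      intro a b hab
      cases a <;> cases b <;> simp_all
    exact h.countable

/-- First-order formulas over the target signature, with all the variables of second-order logic
(individual variables and predicate variables) as pool of variables. -/
abbrev DFormula (L : Signature.{u}) : Type u := Formula L.dagger SOVar

/-- Terms over the target signature. -/
abbrev DTerm (L : Signature.{u}) : Type u := Term L.dagger SOVar

section Atoms

variable {L : Signature.{u}}

/-- The constant `c_R`. -/
def cRel (R : L.Rel) : DTerm L := .app (L := L.dagger) (.cRel R) Fin.elim0

/-- The constant `c_⊥`. -/
def cBot : DTerm L := .app (L := L.dagger) .cBot Fin.elim0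

/-- `Apₙ(s, t₁, …, tₙ)`. -/
def ap (n : ℕ) (s : DTerm L) (ts : Fin n → DTerm L) : DFormula L :=
  .rel (L := L.dagger) (.Ap n) (Fin.cons (α := fun _ => DTerm L) s ts)

/-- `V(t)`. -/
def isV (t : DTerm L) : DFormula L := .rel (L := L.dagger) .V (fun _ => t)

/-- `Uₙ(t)`. -/
def isU (n : ℕ) (t : DTerm L) : DFormula L := .rel (L := L.dagger) (.U n) (fun _ => t)

/-- The sort predicate, `V(v)` or `Uₙ(v)`, belonging to the kind of the variable `v`. -/
def sortOf : SOVar → DFormula L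
  | .ind x => isV (.var (.ind x))
  | .pred n X => isU n (.var (.pred n X))

end Atoms

/-- An `L`-term, read as a term over the target signature. -/
def Term.dagger {L : Signature.{u}} : Term L ℕ → DTerm L
  | .var x => .var (.ind x)
  | .app f ts => .app (L := L.dagger) (.fn f) (fun i => (ts i).dagger)

/-- The translation `φ ↦ φ†`. -/
def SOFormula.dagger {L : Signature.{u}} : SOFormula L → DFormula L
  | .bot => ap 0 cBot Fin.elim0
  | .rel R ts => ap (L.relArity R) (cRel R) (fun i => (ts i).dagger)
  | .pvar n X ts => ap n (.var (.pred n X)) (fun i => (ts i).dagger)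
  | .and A B => .and A.dagger B.dagger
  | .or A B => .or A.dagger B.dagger
  | .imp A B => .imp A.dagger B.dagger
  | .all v A => .all v (.imp (sortOf v) A.dagger)
  | .ex v A => .ex v (.and (sortOf v) A.dagger)

/-- The axioms of the theory `G` (before taking universal closures). -/
inductive GAxiom {L : Signature.{u}} : DFormula L → Prop
  | exV (x : SOVar) : GAxiom (.ex x (isV (.var x)))
  | exU (n : ℕ) (x : SOVar) : GAxiom (.ex x (isU n (.var x)))
  | disjVU (n : ℕ) (x : SOVar) : GAxiom (.imp (isV (.var x)) (isU n (.var x)).neg)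
  | disjUU (m n : ℕ) (h : m ≠ n) (x : SOVar) :
      GAxiom (.imp (isU m (.var x)) (isU n (.var x)).neg)
  | apSort (n : ℕ) (x : SOVar) (y : Fin n → SOVar) :
      GAxiom (.imp (ap n (.var x) fun k => .var (y k))
        (.conj (isU n (.var x) :: List.ofFn fun k => isV (.var (y k)))))
  | constV (c : L.Fun) (hc : L.funArity c = 0) :
      GAxiom (isV (.app (L := L.dagger) (.fn c) fun i => (Fin.cast hc i).elim0))
  | relU (R : L.Rel) : GAxiom (isU (L.relArity R) (cRel R))
  | botU : GAxiom (isU 0 cBot)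
  | botAp : GAxiom (ap 0 cBot Fin.elim0).neg
  | funV (f : L.Fun) (x : Fin (L.funArity f) → SOVar) :
      GAxiom (.imp (.conj (List.ofFn fun k => isV (.var (x k))))
        (isV (.app (L := L.dagger) (.fn f) fun k => .var (x k))))
  | compr (ψ : SOFormula L) (hψ : ψ ∈ Comprehension L) : GAxiom ψ.dagger

/-- The theory `G`: the universal closures of the axioms above. -/
def G (L : Signature.{u}) : Set (DFormula L) := {B | ∃ A, GAxiom A ∧ A.IsUnivClosure B}

end VanDalen

/-! From left to right, a second-order derivation is translated rule by rule. The difficulty is that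
the guards on quantifiers ask for the sort of every instantiating term, while its free variables
carry no sort in unsorted logic. So `SOL.sorted` derives the translation under additional
assumptions `V(x)`, `Uₙ(X)` on finitely many variables, and `FOL.drop_sorts` discharges these by the
nonemptiness axioms of `G`, which is possible because the premises and the conclusion are closed.

From right to left, the argument is semantic but needs no completeness theorem: in a single forcing
model, `termModel`, forcing a translation amounts to second-order provability. A world is a finite
set of formulas added to `Γ`; the domain consists of the individual terms and the second-order
terms; the worlds that prove `⊥` force absurdity. Disjunction and existence are read through a
double negation relative to those worlds, so forcing is classical and `FOL.sound` holds. The truth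
lemma `forces_dagger` says that a world forces `A†` under a well-sorted assignment exactly when it
proves, together with `Γ`, the corresponding instance of `A`; fresh variables play the role of
generic elements. Hence the empty world forces `Γ†` and `G`, therefore `φ†`, and so `φ` is
derivable.

Capture of variables is avoided by parity: terms coming from the domain are renamed to odd indices,
bound variables to even ones. The price is that sentences reappear with doubled indices. As a
derivation uses only finitely many assumptions, an injective renaming undoes the doubling
(`SOL.of_double`). -/

namespace VanDalen

universe u

/-! ## Forcing semantics of first-order logic -/

/-- A structure with a constant domain over a preorder of worlds, in which the worlds of `pole` are
those that force absurdity.  The relations are stable under double negation relative to `pole`. -/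
structure ForcingModel (L : Signature.{u}) where
  World : Type u
  [preorder : Preorder World]
  Dom : Type u
  pole : World → Prop
  pole_mono : ∀ {p q}, p ≤ q → pole p → pole q
  fn : (f : L.Fun) → (Fin (L.funArity f) → Dom) → Dom
  rel : (R : L.Rel) → (Fin (L.relArity R) → Dom) → World → Prop
  rel_mono : ∀ R ds {p q}, p ≤ q → rel R ds p → rel R ds q
  rel_stable : ∀ R ds p,
    (∀ q, p ≤ q → (∀ r, q ≤ r → rel R ds r → pole r) → pole q) → rel R ds p

attribute [instance] ForcingModel.preorder

namespace Term

variable {L : Signature.{u}} {V : Type}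

/-- The value of a term under an assignment. -/
def eval (M : ForcingModel L) (ρ : V → M.Dom) : Term L V → M.Dom
  | var x => ρ x
  | app f ts => M.fn f fun i => (ts i).eval M ρ

theorem eval_congr (M : ForcingModel L) {ρ ρ' : V → M.Dom} (t : Term L V)
    (h : ∀ x ∈ t.vars, ρ x = ρ' x) : t.eval M ρ = t.eval M ρ' := by
  induction t with
  | var x => exact h x rfl
  | app f ts ih =>
    simp only [eval]
    congr 1
    funext i
    exact ih i fun x hx => h x (Set.mem_iUnion.2 ⟨i, hx⟩)

theorem eval_subst [DecidableEq V] (M : ForcingModel L) (ρ : V → M.Dom) (x : V) (t s : Term L V) :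
    (s.subst x t).eval M ρ = s.eval M (Function.update ρ x (t.eval M ρ)) := by
  induction s with
  | var y =>
    by_cases h : y = x
    · subst h; simp [subst, eval]
    · simp [subst, eval, h]
  | app f ts ih => simp only [subst, eval, ih]

theorem subst_of_notMem [DecidableEq V] {x : V} (t : Term L V) {s : Term L V} (h : x ∉ s.vars) :
    s.subst x t = s := by
  induction s with
  | var y =>
    have : y ≠ x := fun e => h (by simp [vars, e])
    simp [subst, this]
  | app f ts ih =>
    simp only [vars, Set.mem_iUnion, not_exists] at h
    simp only [subst]
    congr 1
    funext i
    exact ih i (h i)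

end Term

namespace ForcingModel

variable {L : Signature.{u}} (M : ForcingModel L)

/-- `X` cannot be refuted above `p`. -/
def Dense (X : M.World → Prop) (p : M.World) : Prop :=
  ∀ q, p ≤ q → (∀ r, q ≤ r → X r → M.pole r) → M.pole q

variable {M}

theorem Dense.of {X : M.World → Prop} {p : M.World} (hX : ∀ {p q}, p ≤ q → X p → X q) (h : X p) :
    M.Dense X p := fun q hq k => k q le_rfl (hX hq h)

theorem Dense.mono {X : M.World → Prop} {p q : M.World} (hpq : p ≤ q) (h : M.Dense X p) :
    M.Dense X q := fun r hr k => h r (hpq.trans hr) k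

theorem Dense.join {X : M.World → Prop} {p : M.World} (h : M.Dense (M.Dense X) p) : M.Dense X p :=
  fun q hq k => h q hq fun r hr d => d r le_rfl fun s hs => k s (hr.trans hs)

end ForcingModel

/-! ### Forcing: monotonicity, stability, substitution -/

namespace Formula

variable {L : Signature.{u}} {V : Type} [DecidableEq V]

/-- `A.Forces M ρ p`: the world `p` forces `A` under the assignment `ρ`. -/
def Forces (M : ForcingModel L) : Formula L V → (V → M.Dom) → M.World → Prop
  | bot, _, p => M.pole p
  | eq s t, ρ, p => s.eval M ρ = t.eval M ρ ∨ M.pole p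
  | rel R ts, ρ, p => M.rel R (fun i => (ts i).eval M ρ) p
  | and A B, ρ, p => A.Forces M ρ p ∧ B.Forces M ρ p
  | or A B, ρ, p => M.Dense (fun q => A.Forces M ρ q ∨ B.Forces M ρ q) p
  | imp A B, ρ, p => ∀ q, p ≤ q → A.Forces M ρ q → B.Forces M ρ q
  | all x A, ρ, p => ∀ d, A.Forces M (Function.update ρ x d) p
  | ex x A, ρ, p => M.Dense (fun q => ∃ d, A.Forces M (Function.update ρ x d) q) p

variable {M : ForcingModel L}

theorem Forces.mono {A : Formula L V} {ρ : V → M.Dom} {p q : M.World} (hpq : p ≤ q)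
    (h : A.Forces M ρ p) : A.Forces M ρ q := by
  induction A generalizing ρ with
  | bot => exact M.pole_mono hpq h
  | eq s t => exact h.imp id (M.pole_mono hpq)
  | rel R ts => exact M.rel_mono _ _ hpq h
  | and A B ihA ihB => exact ⟨ihA h.1, ihB h.2⟩
  | or A B ihA ihB => exact ForcingModel.Dense.mono hpq h
  | imp A B ihA ihB => exact fun r hr => h r (hpq.trans hr)
  | all x A ih => exact fun d => ih (h d)
  | ex x A ih => exact ForcingModel.Dense.mono hpq h

/-- This makes the semantics classical. The clauses for `or` and `ex` are dense by definition and
collapse by `Dense.join`, relational atoms are stable by assumption on the model, and the remaining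
connectives inherit stability from their parts. -/
theorem Forces.stable {A : Formula L V} {ρ : V → M.Dom} {p : M.World}
    (h : M.Dense (A.Forces M ρ) p) : A.Forces M ρ p := by
  induction A generalizing ρ p with
  | bot => exact h p le_rfl fun r _ hr => hr
  | eq s t =>
    -- Identity of values does not depend on the world: if it fails, only worlds of the pole force
    -- the equation, and density puts `p` into the pole.
    by_cases e : s.eval M ρ = t.eval M ρ
    · exact Or.inl e
    · exact Or.inr (h p le_rfl fun r _ hr => hr.resolve_left e)
  | rel R ts => exact M.rel_stable _ _ _ h
  | and A B ihA ihB =>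
    exact ⟨ihA fun q hq k => h q hq fun r hr a => k r hr a.1,
      ihB fun q hq k => h q hq fun r hr a => k r hr a.2⟩
  | or A B ihA ihB => exact ForcingModel.Dense.join h
  | imp A B ihA ihB =>
    exact fun q hq a => ihB fun r hr k =>
      h r (hq.trans hr) fun s hs f => k s hs (f s le_rfl (a.mono (hr.trans hs)))
  | all x A ih => exact fun d => ih fun q hq k => h q hq fun r hr a => k r hr (a d)
  | ex x A ih => exact ForcingModel.Dense.join h

theorem Forces.of_pole {A : Formula L V} {ρ : V → M.Dom} {p : M.World} (h : M.pole p) :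
    A.Forces M ρ p := Forces.stable fun _ hq _ => M.pole_mono hq h

/-- An equality of predicates on worlds, rather than an equivalence at one world, because the
clauses for `or`, `imp` and `ex` look at later worlds. -/
theorem forces_congr {A : Formula L V} {ρ ρ' : V → M.Dom} (h : ∀ x ∈ A.fv, ρ x = ρ' x) :
    A.Forces M ρ = A.Forces M ρ' := by
  induction A generalizing ρ ρ' with
  | bot => rfl
  | eq s t =>
    funext p
    simp only [Forces, Term.eval_congr M s fun x hx => h x (Or.inl hx),
      Term.eval_congr M t fun x hx => h x (Or.inr hx)]
  | rel R ts =>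
    funext p
    simp only [Forces, fun i => Term.eval_congr M (ts i) fun x hx => h x (Set.mem_iUnion.2 ⟨i, hx⟩)]
  | and A B ihA ihB | or A B ihA ihB | imp A B ihA ihB =>
    funext p
    simp only [Forces, ihA fun x hx => h x (Or.inl hx), ihB fun x hx => h x (Or.inr hx)]
  | all x A ih | ex x A ih =>
    have key : ∀ d, A.Forces M (Function.update ρ x d) = A.Forces M (Function.update ρ' x d) := by
      intro d
      refine ih fun y hy => ?_
      by_cases e : y = x
      · subst e; simp
      · simpa [e] using h y ⟨hy, e⟩
    funext p
    simp only [Forces, key]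

theorem forces_update {A : Formula L V} {ρ : V → M.Dom} {x : V} (h : x ∉ A.fv) (d : M.Dom) :
    A.Forces M (Function.update ρ x d) = A.Forces M ρ :=
  forces_congr fun y hy => Function.update_of_ne (by rintro rfl; exact h hy) _ _

theorem subst_of_notMem {A : Formula L V} {x : V} (t : Term L V) (h : x ∉ A.fv) :
    A.subst x t = A := by
  induction A with
  | bot => rfl
  | eq r s =>
    simp only [fv, Set.mem_union, not_or] at h
    simp [subst, Term.subst_of_notMem t h.1, Term.subst_of_notMem t h.2]
  | rel R ts =>
    simp only [fv, Set.mem_iUnion, not_exists] at h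
    simp [subst, fun i => Term.subst_of_notMem t (h i)]
  | and A B ihA ihB | or A B ihA ihB | imp A B ihA ihB =>
    simp only [fv, Set.mem_union, not_or] at h
    simp [subst, ihA h.1, ihB h.2]
  | all y A ih | ex y A ih =>
    by_cases e : y = x
    · simp [subst, e]
    · have : x ∉ A.fv := fun hx => h ⟨hx, fun e' => e (Eq.symm e')⟩
      simp [subst, ih this]

theorem forces_subst {A : Formula L V} {x : V} {t : Term L V} (ht : A.FreeFor x t)
    (ρ : V → M.Dom) :
    (A.subst x t).Forces M ρ = A.Forces M (Function.update ρ x (t.eval M ρ)) := by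
  induction A generalizing ρ with
  | bot => rfl
  | eq r s => simp only [subst, Forces, Term.eval_subst]
  | rel R ts => simp only [subst, Forces, Term.eval_subst]
  | and A B ihA ihB | or A B ihA ihB | imp A B ihA ihB =>
    simp only [subst, Forces, ihA ht.1, ihB ht.2]
  | all y A ih | ex y A ih =>
    rcases ht with h | ⟨hy, hA⟩
    · rw [subst_of_notMem t h, forces_update h]
    · by_cases e : y = x
      · subst e
        simp [subst, Forces]
      · have key : ∀ d, (A.subst x t).Forces M (Function.update ρ y d) =
            A.Forces M (Function.update (Function.update ρ x (t.eval M ρ)) y d) := by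
          intro d
          rw [ih hA, Function.update_comm e, Term.eval_congr M (ρ' := ρ) t]
          intro z hz
          exact Function.update_of_ne (by rintro rfl; exact hy hz) _ _
        simp [subst, Forces, e, key]

theorem forces_conj {l : List (Formula L V)} {ρ : V → M.Dom} {p : M.World} :
    (conj l).Forces M ρ p ↔ ∀ A ∈ l, A.Forces M ρ p := by
  induction l with
  | nil => simp [conj, top, Forces]
  | cons A l ih =>
    cases l with
    | nil => simp [conj]
    | cons B l => rw [conj, Forces, ih]; simp

theorem forces_allList {A : Formula L V} {p : M.World} (h : ∀ ρ, A.Forces M ρ p) (xs : List V)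
    (ρ : V → M.Dom) : (allList xs A).Forces M ρ p := by
  induction xs generalizing ρ with
  | nil => exact h ρ
  | cons x xs ih => exact fun d => ih _

theorem IsUnivClosure.forces {A B : Formula L V} (hB : A.IsUnivClosure B) {p : M.World}
    (h : ∀ ρ, A.Forces M ρ p) (ρ : V → M.Dom) : B.Forces M ρ p := by
  obtain ⟨xs, -, -, rfl⟩ := hB
  exact forces_allList h xs ρ

end Formula

/-! ### Soundness of first-order deduction for forcing -/

open Formula in
-- Outside the pole a forced equation is a true identity in the domain; inside the pole everything
-- is forced.
theorem EqAxiom.forces {L : Signature.{u}} {V : Type} [DecidableEq V] {M : ForcingModel L}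
    {A : Formula L V} (h : EqAxiom A) (ρ : V → M.Dom) (p : M.World) : A.Forces M ρ p := by
  cases h with
  | refl x => exact Or.inl rfl
  | symm x y => exact fun q _ h => h.imp Eq.symm id
  | trans x y z =>
    rintro q - ⟨h₁, h₂⟩
    rcases h₁ with h₁ | h₁
    · exact h₂.imp h₁.trans id
    · exact Or.inr h₁
  | relCongr R x y =>
    intro q _ h r hr k
    rw [forces_conj] at h
    by_cases hp : M.pole r
    · exact Forces.of_pole hp
    · have : (fun k => ρ (x k)) = fun k => ρ (y k) := by
        funext k
        exact ((h _ ((List.mem_ofFn' _ _).2 ⟨k, rfl⟩)).resolve_right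
          fun h => hp (M.pole_mono hr h))
      simp only [Forces, Term.eval] at k ⊢
      rwa [← this]
  | funCongr f x y =>
    intro q _ h
    rw [forces_conj] at h
    by_cases hp : M.pole q
    · exact Or.inr hp
    · have : (fun k => ρ (x k)) = fun k => ρ (y k) := by
        funext k
        exact (h _ ((List.mem_ofFn' _ _).2 ⟨k, rfl⟩)).resolve_right hp
      left
      simp only [Term.eval, this]

-- The induction ranges over all assignments and worlds, since the quantifier rules change the
-- former and discharging an assumption moves to a later world. The rules `orE`, `exE` and `raa`
-- rest on `Forces.stable`.
open Formula in
theorem FOL.sound {L : Signature.{u}} {V : Type} [DecidableEq V] {M : ForcingModel L}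
    {Γ : Set (Formula L V)} {A : Formula L V} (h : FOL Γ A) (ρ : V → M.Dom) (p : M.World)
    (hΓ : ∀ B ∈ Γ, B.Forces M ρ p) : A.Forces M ρ p := by
  have insert_forces : ∀ {Γ : Set (Formula L V)} {A : Formula L V} {ρ : V → M.Dom} {p q : M.World},
      p ≤ q → (∀ B ∈ Γ, B.Forces M ρ p) → A.Forces M ρ q →
      ∀ B ∈ insert A Γ, B.Forces M ρ q := by
    rintro Γ A ρ p q hpq h hA B (rfl | hB)
    · exact hA
    · exact (h B hB).mono hpq
  induction h generalizing ρ p with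
  | assume h => exact hΓ _ h
  | weaken h d ih => exact ih ρ p fun B hB => hΓ B (h hB)
  | eqAx h hB => exact hB.forces (fun ρ => h.forces ρ p) ρ
  | andI d e ihd ihe => exact ⟨ihd ρ p hΓ, ihe ρ p hΓ⟩
  | andE₁ d ih => exact (ih ρ p hΓ).1
  | andE₂ d ih => exact (ih ρ p hΓ).2
  | orI₁ d ih =>
    exact ForcingModel.Dense.of (fun hpq h => h.imp (Forces.mono hpq) (Forces.mono hpq))
      (Or.inl (ih ρ p hΓ))
  | orI₂ d ih =>
    exact ForcingModel.Dense.of (fun hpq h => h.imp (Forces.mono hpq) (Forces.mono hpq))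
      (Or.inr (ih ρ p hΓ))
  | orE d e₁ e₂ ih ih₁ ih₂ =>
    refine Forces.stable fun q hq k => ih ρ p hΓ q hq fun r hr h => k r hr ?_
    rcases h with h | h
    · exact ih₁ ρ r (insert_forces (hq.trans hr) hΓ h)
    · exact ih₂ ρ r (insert_forces (hq.trans hr) hΓ h)
  | impI d ih => exact fun q hq h => ih ρ q (insert_forces hq hΓ h)
  | impE d e ihd ihe => exact ihd ρ p hΓ p le_rfl (ihe ρ p hΓ)
  | botE d ih => exact Forces.of_pole (ih ρ p hΓ)
  -- The refutation `k` of `A` above `q` is by definition the forcing of `A.neg` at `q`.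
  | raa d ih => exact Forces.stable fun q hq k => ih ρ q (insert_forces hq hΓ k)
  | allI hx d ih =>
    exact fun a => ih _ p fun B hB => by rw [forces_update (hx B hB)]; exact hΓ B hB
  | allE ht d ih => rw [forces_subst ht]; exact ih ρ p hΓ _
  | @exI Γ A x t ht d ih =>
    refine ForcingModel.Dense.of (fun hpq ⟨d, h⟩ => ⟨d, h.mono hpq⟩)
      ⟨t.eval M ρ, ?_⟩
    rw [← forces_subst ht]
    exact ih ρ p hΓ
  | @exE Γ Δ A C x hΔ hx hC d e ihd ihe =>
    refine Forces.stable fun q hq k => ihd ρ p hΓ q hq fun r hr ⟨a, h⟩ => k r hr ?_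
    -- The conclusion does not see the eigenvariable, so it may be evaluated where that variable
    -- denotes the witness `a`.
    rw [← forces_update hC a]
    refine ihe _ r (insert_forces (hq.trans hr) (fun B hB => ?_) h)
    rw [forces_update (hx B hB)]
    exact hΓ B (hΔ hB)

/-! ## Derivability is preserved by the translation -/

/-! ### Free variables of translations and closures -/

section FreeVariables

variable {L : Signature.{u}}

theorem Formula.fv_allList {V : Type} {L : Signature.{u}} (xs : List V) (A : Formula L V) :
    (allList xs A).fv = A.fv \ {x | x ∈ xs} := by
  induction xs with
  | nil => simp [allList]
  | cons x xs ih =>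
    change (allList xs A).fv \ {x} = _
    rw [ih]
    ext y
    simp only [Set.mem_sdiff, Set.mem_ofPred_eq, List.mem_cons, Set.mem_singleton_iff]
    tauto

theorem Formula.IsUnivClosure.fv {V : Type} {L : Signature.{u}} {A B : Formula L V}
    (h : A.IsUnivClosure B) : B.fv = ∅ := by
  obtain ⟨xs, -, hxs, rfl⟩ := h
  rw [fv_allList, Set.sdiff_eq_empty]
  exact fun x hx => (hxs x).2 hx

theorem Formula.isUnivClosure_self {V : Type} {L : Signature.{u}} {A : Formula L V}
    (h : A.fv = ∅) : A.IsUnivClosure A := ⟨[], by simp, by simp [h], rfl⟩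

theorem fv_of_mem_G {B : DFormula L} (h : B ∈ G L) : B.fv = ∅ := by
  obtain ⟨A, -, h⟩ := h
  exact h.fv

theorem Term.vars_dagger (t : Term L ℕ) : t.dagger.vars = SOVar.ind '' t.vars := by
  induction t with
  | var x => simp [Term.dagger, Term.vars]
  | app f ts ih =>
    simp only [Term.dagger, Term.vars, Set.image_iUnion]
    exact Set.iUnion_congr ih

theorem fv_ap (n : ℕ) (s : DTerm L) (ts : Fin n → DTerm L) :
    (ap n s ts).fv = s.vars ∪ ⋃ i, (ts i).vars := by
  ext x
  simp only [ap, Formula.fv, Set.mem_iUnion, Set.mem_union]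
  exact Fin.exists_fin_succ

theorem fv_isV (t : DTerm L) : (isV t).fv = t.vars := by
  ext x
  simp only [isV, Formula.fv, Set.mem_iUnion]
  exact ⟨fun ⟨_, h⟩ => h, fun h => ⟨(0 : Fin 1), h⟩⟩

theorem fv_isU (n : ℕ) (t : DTerm L) : (isU n t).fv = t.vars := by
  ext x
  simp only [isU, Formula.fv, Set.mem_iUnion]
  exact ⟨fun ⟨_, h⟩ => h, fun h => ⟨(0 : Fin 1), h⟩⟩

theorem vars_cRel (R : L.Rel) : (cRel R : DTerm L).vars = ∅ :=
  Set.iUnion_eq_empty.2 fun i : Fin 0 => i.elim0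

theorem vars_cBot : (cBot : DTerm L).vars = ∅ :=
  Set.iUnion_eq_empty.2 fun i : Fin 0 => i.elim0

theorem fv_sortOf (v : SOVar) : (sortOf v : DFormula L).fv = {v} := by
  cases v with
  | ind x => simp [sortOf, fv_isV, Term.vars]
  | pred n X => simp [sortOf, fv_isU, Term.vars]

/-- The guard of a quantifier mentions only the variable being bound, and the codes `cRel R` and
`cBot` are closed. Hence eigenvariable conditions carry over to translations. -/
theorem SOFormula.fv_dagger (A : SOFormula L) : A.dagger.fv = A.fv := by
  induction A with
  | bot => simp [dagger, fv, fv_ap, vars_cBot]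
  | rel R ts => simp [dagger, fv, fv_ap, vars_cRel, Term.vars_dagger]
  | pvar n X ts => simp [dagger, fv, fv_ap, Term.vars, Term.vars_dagger]
  | and A B ihA ihB | or A B ihA ihB | imp A B ihA ihB =>
    simp [dagger, fv, Formula.fv, ihA, ihB]
  | all v A ih | ex v A ih => simp [dagger, fv, Formula.fv, ih, fv_sortOf]

theorem SOFormula.fv_allList (vs : List SOVar) (A : SOFormula L) :
    (allList vs A).fv = A.fv \ {v | v ∈ vs} := by
  induction vs with
  | nil => simp [allList]
  | cons x xs ih =>
    change (allList xs A).fv \ {x} = _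
    rw [ih]
    ext y
    simp only [Set.mem_sdiff, Set.mem_ofPred_eq, List.mem_cons, Set.mem_singleton_iff]
    tauto

theorem SOFormula.fv_of_mem_comprehension {A : SOFormula L} (h : A ∈ Comprehension L) :
    A.fv = ∅ := by
  obtain ⟨n, X, x, ψ, -, -, vs, -, hvs, rfl⟩ := h
  rw [fv_allList, Set.sdiff_eq_empty]
  exact fun v hv => (hvs v).2 hv

end FreeVariables

/-! ### Translation commutes with substitution -/

section Substitution

variable {L : Signature.{u}}

theorem subst_ap (n : ℕ) (s : DTerm L) (ts : Fin n → DTerm L) (v : SOVar) (t : DTerm L) :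
    (ap n s ts).subst v t = ap n (s.subst v t) fun i => (ts i).subst v t := by
  simp only [ap, Formula.subst]
  congr 1
  funext i
  exact Fin.cases (motive := fun i : Fin (n + 1) =>
    (Fin.cons (α := fun _ => DTerm L) s ts i).subst v t =
      Fin.cons (α := fun _ => DTerm L) (s.subst v t) (fun i => (ts i).subst v t) i)
    rfl (fun _ => rfl) i

theorem subst_sortOf {v w : SOVar} (h : w ≠ v) (t : DTerm L) :
    (sortOf w : DFormula L).subst v t = sortOf w :=
  Formula.subst_of_notMem t (by simpa [fv_sortOf] using h.symm)

theorem freeFor_sortOf (v w : SOVar) (t : DTerm L) : (sortOf w : DFormula L).FreeFor v t := by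
  cases w <;> trivial

theorem Term.dagger_subst (s : Term L ℕ) (x : ℕ) (t : Term L ℕ) :
    (s.subst x t).dagger = s.dagger.subst (.ind x) t.dagger := by
  induction s with
  | var y => by_cases h : y = x <;> simp [subst, Term.dagger, h]
  | app f ts ih => exact congrArg (Term.app (L := L.dagger) (.fn f)) (funext ih)

theorem SOFormula.dagger_subst (A : SOFormula L) (x : ℕ) (t : Term L ℕ) :
    (A.subst x t).dagger = A.dagger.subst (.ind x) t.dagger := by
  induction A with
  | bot =>
    rw [subst, Formula.subst_of_notMem]
    simp [fv_dagger, fv]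
  | rel R ts =>
    simp only [subst, dagger, subst_ap, Term.dagger_subst]
    rw [Term.subst_of_notMem]
    simp [vars_cRel]
  | pvar n X ts => simp [subst, dagger, subst_ap, Term.dagger_subst, Term.subst]
  | and A B ihA ihB | or A B ihA ihB | imp A B ihA ihB =>
    simp [subst, dagger, Formula.subst, ihA, ihB]
  | all v A ih | ex v A ih =>
    by_cases h : v = .ind x
    · simp [subst, dagger, Formula.subst, h]
    · simp [subst, dagger, Formula.subst, h, ih, subst_sortOf h]

theorem SOFormula.FreeFor.dagger {A : SOFormula L} {x : ℕ} {t : Term L ℕ} (h : A.FreeFor x t) :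
    A.dagger.FreeFor (.ind x) t.dagger := by
  induction A with
  | bot | rel R ts | pvar n X ts => trivial
  | and A B ihA ihB | or A B ihA ihB | imp A B ihA ihB => exact ⟨ihA h.1, ihB h.2⟩
  | all v A ih | ex v A ih =>
    rcases h with h | ⟨hv, h⟩
    · rw [← fv_dagger] at h
      exact Or.inl h
    · rw [← Term.vars_dagger] at hv
      exact Or.inr ⟨hv, freeFor_sortOf _ _ _, ih h⟩

/-- The individual term over the target signature that codes a second-order term. -/
def SOTerm.dagger : {n : ℕ} → SOTerm L n → DTerm L
  | _, pvar n X => .var (.pred n X)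
  | _, rel R => cRel R
  | _, bot => cBot

theorem SOTerm.vars_dagger {n : ℕ} (T : SOTerm L n) : T.dagger.vars = T.vars := by
  cases T with
  | pvar n X => rfl
  | rel R => exact vars_cRel R
  | bot => exact vars_cBot

theorem SOTerm.dagger_atom {n : ℕ} (T : SOTerm L n) (ts : Fin n → Term L ℕ) :
    (T.atom ts).dagger = ap n T.dagger fun i => (ts i).dagger := by
  cases T with
  | pvar n X | rel R => rfl
  | bot =>
    simp only [atom, SOFormula.dagger, SOTerm.dagger]
    congr 1
    exact Subsingleton.elim _ _

theorem Term.dagger_subst_pred (s : Term L ℕ) (n X : ℕ) (t : DTerm L) :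
    s.dagger.subst (.pred n X) t = s.dagger :=
  Term.subst_of_notMem t (by simp [Term.vars_dagger])

/-- A predicate variable becomes an ordinary argument of `Apₙ`, so a second-order instantiation
turns into the first-order substitution of a code. -/
theorem SOFormula.dagger_subst₂ (A : SOFormula L) {n : ℕ} (X : ℕ) (T : SOTerm L n) :
    (A.subst₂ n X T).dagger = A.dagger.subst (.pred n X) T.dagger := by
  induction A with
  | bot =>
    rw [subst₂, Formula.subst_of_notMem]
    simp [fv_dagger, fv]
  | rel R ts =>
    simp only [subst₂, dagger, subst_ap, Term.dagger_subst_pred]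
    rw [Term.subst_of_notMem]
    simp [vars_cRel]
  | pvar m Y ts =>
    simp only [subst₂, dagger, subst_ap, Term.dagger_subst_pred, Term.subst, SOVar.pred.injEq]
    by_cases h : m = n ∧ Y = X
    · obtain ⟨rfl, rfl⟩ := h
      simp [SOTerm.dagger_atom]
    · simp [h, dagger]
  | and A B ihA ihB | or A B ihA ihB | imp A B ihA ihB =>
    simp [subst₂, dagger, Formula.subst, ihA, ihB]
  | all v A ih | ex v A ih =>
    by_cases h : v = .pred n X
    · simp [subst₂, dagger, Formula.subst, h]
    · simp [subst₂, dagger, Formula.subst, h, ih, subst_sortOf h]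

theorem SOFormula.FreeFor₂.dagger {A : SOFormula L} {n X : ℕ} {T : SOTerm L n}
    (h : A.FreeFor₂ n X T) : A.dagger.FreeFor (.pred n X) T.dagger := by
  induction A with
  | bot | rel R ts | pvar n X ts => trivial
  | and A B ihA ihB | or A B ihA ihB | imp A B ihA ihB => exact ⟨ihA h.1, ihB h.2⟩
  | all v A ih | ex v A ih =>
    rcases h with h | ⟨hv, h⟩
    · rw [← fv_dagger] at h
      exact Or.inl h
    · rw [← SOTerm.vars_dagger] at hv
      exact Or.inr ⟨hv, freeFor_sortOf _ _ _, ih h⟩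

theorem Formula.subst_allList {V : Type} [DecidableEq V] (xs : List V) (A : Formula L V) {y : V}
    (hy : y ∉ xs) (t : Term L V) :
    (Formula.allList xs A).subst y t = Formula.allList xs (A.subst y t) := by
  induction xs with
  | nil => rfl
  | cons x xs ih =>
    simp only [List.mem_cons, not_or] at hy
    change (Formula.all x (Formula.allList xs A)).subst y t = _
    rw [Formula.subst, if_neg (fun e => hy.1 e.symm), ih hy.2]
    rfl

theorem Formula.FreeFor.allList {V : Type} {xs : List V} {A : Formula L V} {y : V}
    {t : Term L V} (h : A.FreeFor y t) (ht : ∀ x ∈ xs, x ∉ t.vars) :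
    (Formula.allList xs A).FreeFor y t := by
  induction xs with
  | nil => exact h
  | cons x xs ih =>
    exact Or.inr ⟨ht x (by simp), ih fun z hz => ht z (List.mem_cons_of_mem _ hz)⟩

end Substitution

/-! ### Derived first-order rules -/

namespace FOL

variable {L : Signature.{u}} {V : Type} [DecidableEq V]

theorem conjI {Γ : Set (Formula L V)} {l : List (Formula L V)} (h : ∀ A ∈ l, FOL Γ A) :
    FOL Γ (.conj l) := by
  induction l with
  | nil => exact impI (assume (Set.mem_insert _ _))
  | cons A l ih =>
    cases l with
    | nil => exact h A (by simp)
    | cons B l =>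
      exact andI (h A (by simp)) (ih fun C hC => h C (List.mem_cons_of_mem _ hC))

/-- Instantiation of a block of universal quantifiers over a quantifier-free formula by terms in
which the quantified variables do not occur. -/
theorem allList_inst {Γ : Set (Formula L V)} {n : ℕ} {x : Fin n → V} (hx : Function.Injective x)
    (t : Fin n → Term L V) (ht : ∀ i j, x i ∉ (t j).vars) (B : (Fin n → Term L V) → Formula L V)
    (hB : ∀ s y u, (B s).subst y u = B fun i => (s i).subst y u)
    (hfree : ∀ s y u, (B s).FreeFor y u)
    (d : FOL Γ (.allList (List.ofFn x) (B fun i => .var (x i)))) : FOL Γ (B t) := by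
  -- After `m` instantiations the first `m` arguments are final: no `x i` occurs in any `t j`, so
  -- later substitutions leave them alone and iterated substitution agrees with the simultaneous
  -- one.
  have key : ∀ m ≤ n, FOL Γ (.allList ((List.ofFn x).drop m)
      (B fun i => if (i : ℕ) < m then t i else .var (x i))) := by
    intro m hm
    induction m with
    | zero => simpa using d
    | succ m ih =>
      have hm' : m < (List.ofFn x).length := by simpa using hm
      have e := ih (by omega)
      rw [List.drop_eq_getElem_cons hm'] at e
      simp only [List.getElem_ofFn] at e
      have notMem : x ⟨m, hm⟩ ∉ (List.ofFn x).drop (m + 1) := by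
        have nd : ((List.ofFn x).drop m).Nodup :=
          (List.nodup_ofFn.2 hx).sublist (List.drop_sublist _ _)
        rw [List.drop_eq_getElem_cons hm', List.nodup_cons] at nd
        simpa using nd.1
      have e' := FOL.allE (t := t ⟨m, hm⟩) ((hfree _ _ _).allList (xs := (List.ofFn x).drop (m + 1))
        (fun y hy => ?_)) e
      · rw [Formula.subst_allList _ _ notMem, hB] at e'
        convert e' using 3
        funext i
        by_cases h : (i : ℕ) < m
        · simp [h, Nat.lt_succ_of_lt h, Term.subst_of_notMem _ (ht ⟨m, hm⟩ i)]
        · by_cases h' : (i : ℕ) = m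
          · obtain rfl : i = ⟨m, hm⟩ := Fin.ext h'
            simp [Term.subst]
          · have h₂ : ¬ (i : ℕ) < m + 1 := by omega
            have h₃ : x i ≠ x ⟨m, hm⟩ := fun e => h' (congrArg Fin.val (hx e))
            simp [h, h₂, Term.subst, h₃]
      · obtain ⟨i, rfl⟩ := (List.mem_ofFn' _ _).1 (List.mem_of_mem_drop hy)
        exact ht _ _
  simpa [List.drop_eq_nil_of_le, Formula.allList] using key n le_rfl

end FOL

/-! ### From second-order to first-order derivations -/

section Derivations

variable {L : Signature.{u}}

/-- The translation of `Γ`, the theory `G`, and sort assumptions for the variables in `S`. -/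
def sortedContext (Γ : Set (SOFormula L)) (S : Set SOVar) : Set (DFormula L) :=
  SOFormula.dagger '' Γ ∪ G L ∪ sortOf '' S

theorem sortedContext_mono {Γ Δ : Set (SOFormula L)} {S T : Set SOVar} (h : Γ ⊆ Δ) (hS : S ⊆ T) :
    sortedContext Γ S ⊆ sortedContext Δ T :=
  Set.union_subset_union (Set.union_subset_union_left _ (Set.image_mono h)) (Set.image_mono hS)

theorem sortedContext_insert (A : SOFormula L) (Γ : Set (SOFormula L)) (S : Set SOVar) :
    sortedContext (insert A Γ) S = insert A.dagger (sortedContext Γ S) := by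
  simp [sortedContext, Set.image_insert_eq, Set.insert_union]

theorem sortedContext_subset_insert_sortOf (Γ : Set (SOFormula L)) (S : Set SOVar) (v : SOVar) :
    sortedContext Γ S ⊆ insert (sortOf v) (sortedContext Γ (S \ {v})) := by
  rintro B (hB | ⟨w, hw, rfl⟩)
  · exact Or.inr (Or.inl hB)
  · by_cases h : w = v
    · exact Or.inl (h ▸ rfl)
    · exact Or.inr (Or.inr ⟨w, ⟨hw, h⟩, rfl⟩)

theorem notMem_fv_of_mem_sortedContext {Γ : Set (SOFormula L)} {v : SOVar}
    (h : ∀ B ∈ Γ, v ∉ B.fv) {S : Set SOVar} (hS : v ∉ S) :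
    ∀ B ∈ sortedContext Γ S, v ∉ B.fv := by
  rintro B ((⟨A, hA, rfl⟩ | hB) | ⟨w, hw, rfl⟩)
  · rw [SOFormula.fv_dagger]
    exact h A hA
  · simp [fv_of_mem_G hB]
  · rw [fv_sortOf]
    rintro rfl
    exact hS hw

theorem FOL.of_mem_G {Γ : Set (SOFormula L)} {S : Set SOVar} {A : DFormula L} (h : GAxiom A)
    (hA : A.fv = ∅) : FOL (sortedContext Γ S) A :=
  .assume (Or.inl (Or.inr ⟨A, h, Formula.isUnivClosure_self hA⟩))

theorem Term.vars_finite {V : Type} (t : Term L V) : t.vars.Finite := by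
  induction t with
  | var x => exact Set.finite_singleton x
  | app f ts ih => exact Set.finite_iUnion ih

theorem FOL.isV_dagger {Γ : Set (SOFormula L)} {S : Set SOVar} (t : Term L ℕ)
    (h : SOVar.ind '' t.vars ⊆ S) : FOL (sortedContext Γ S) (isV t.dagger) := by
  induction t with
  | var x => exact .assume (Or.inr ⟨.ind x, h ⟨x, rfl, rfl⟩, rfl⟩)
  | app f ts ih =>
    -- `N` bounds the variables of the whole term, so the variables `N + 1 + i` are distinct and
    -- absent from the arguments; the axiom `funV` stated with them can be instantiated without
    -- capture.
    obtain ⟨N, hN⟩ := (Term.app f ts).vars_finite.bddAbove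
    let x : Fin (L.funArity f) → SOVar := fun i => .ind (N + 1 + i)
    have hx : Function.Injective x := fun i j e => by
      simp only [x, SOVar.ind.injEq] at e
      exact Fin.ext (by omega)
    let B : (Fin (L.funArity f) → DTerm L) → DFormula L := fun s =>
      .imp (.conj (List.ofFn fun k => isV (s k))) (isV (.app (L := L.dagger) (.fn f) s))
    have conj_subst : ∀ (l : List (DFormula L)) y u,
        (Formula.conj l).subst y u = .conj (l.map (Formula.subst y u)) := by
      intro l y u
      induction l with
      | nil => rfl
      | cons A l ih =>
        cases l with
        | nil => rfl
        | cons C l => simp only [Formula.conj, Formula.subst, ih, List.map_cons]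
    have conj_free : ∀ (l : List (DFormula L)) y u, (∀ A ∈ l, A.FreeFor y u) →
        (Formula.conj l).FreeFor y u := by
      intro l y u hl
      induction l with
      | nil => exact ⟨trivial, trivial⟩
      | cons A l ih =>
        cases l with
        | nil => exact hl A (by simp)
        | cons C l => exact ⟨hl A (by simp), ih fun D hD => hl D (List.mem_cons_of_mem _ hD)⟩
    have conj_fv : ∀ (l : List (DFormula L)) y, y ∈ (Formula.conj l).fv ↔ ∃ A ∈ l, y ∈ A.fv := by
      intro l y
      induction l with
      | nil => simp [Formula.conj, Formula.top, Formula.fv]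
      | cons A l ih =>
        cases l with
        | nil => simp [Formula.conj]
        | cons C l => rw [Formula.conj, Formula.fv, Set.mem_union, ih]; simp
    have d : FOL (sortedContext Γ S) (B fun k => (ts k).dagger) := by
      refine FOL.allList_inst hx _ ?_ B ?_ ?_ ?_
      · rintro i j hi
        rw [Term.vars_dagger] at hi
        obtain ⟨k, hk, e⟩ := hi
        simp only [x, SOVar.ind.injEq] at e
        have : k ≤ N := hN (Set.mem_iUnion.2 ⟨j, hk⟩)
        omega
      · intro s y u
        simp only [B, Formula.subst, conj_subst, List.map_ofFn]
        rfl
      · intro s y u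
        refine ⟨conj_free _ _ _ ?_, trivial⟩
        rintro A hA
        obtain ⟨k, rfl⟩ := (List.mem_ofFn' _ _).1 hA
        trivial
      -- `G` contains the closures in every order of the quantifiers, in particular the order of
      -- `x`.
      · refine .assume (Or.inl (Or.inr ⟨_, .funV f x, _, List.nodup_ofFn.2 hx, ?_, rfl⟩))
        intro y
        simp only [Formula.fv, Set.mem_union, conj_fv, fv_isV, List.mem_ofFn]
        constructor
        · rintro ⟨k, rfl⟩
          exact Or.inl ⟨_, ⟨k, rfl⟩, by simp [fv_isV, Term.vars]⟩
        · rintro (⟨_, ⟨k, rfl⟩, hy⟩ | hy)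
          · simp only [fv_isV, Term.vars, Set.mem_singleton_iff] at hy
            exact ⟨k, hy.symm⟩
          · simp only [Term.vars, Set.mem_iUnion, Set.mem_singleton_iff] at hy
            obtain ⟨k, hy⟩ := hy
            exact ⟨k, hy.symm⟩
    refine .impE d (.conjI fun A hA => ?_)
    obtain ⟨k, rfl⟩ := (List.mem_ofFn' _ _).1 hA
    exact ih k ((Set.image_mono (Set.subset_iUnion (fun i => (ts i).vars) k)).trans h)

theorem FOL.isU_dagger {Γ : Set (SOFormula L)} {S : Set SOVar} {n : ℕ} (T : SOTerm L n)
    (h : T.vars ⊆ S) : FOL (sortedContext Γ S) (isU n T.dagger) := by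
  cases T with
  | pvar n X => exact .assume (Or.inr ⟨.pred n X, h rfl, rfl⟩)
  | rel R => exact .of_mem_G (.relU R) (by rw [fv_isU]; exact vars_cRel R)
  | bot => exact .of_mem_G .botU (by rw [fv_isU]; exact vars_cBot)

theorem FOL.exists_sortOf {Γ : Set (SOFormula L)} {S : Set SOVar} (v : SOVar) :
    FOL (sortedContext Γ S) (.ex v (sortOf v)) := by
  have h : (Formula.ex v (sortOf v) : DFormula L).fv = ∅ := by simp [Formula.fv, fv_sortOf]
  cases v with
  | ind x => exact .of_mem_G (.exV _) h
  | pred n X => exact .of_mem_G (.exU n _) h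

/-- Second-order falsity is translated to an atom; the axiom `¬Ap₀(c_⊥)` bridges the gap to
first-order falsity in the cases `botE` and `raa`. -/
theorem FOL.bot_of_dagger {Γ : Set (SOFormula L)} {S : Set SOVar}
    (d : FOL (sortedContext Γ S) (SOFormula.bot : SOFormula L).dagger) :
    FOL (sortedContext Γ S) .bot :=
  .impE (.of_mem_G .botAp (by
    change (SOFormula.bot : SOFormula L).dagger.fv ∪ ∅ = ∅
    simp [SOFormula.fv_dagger, SOFormula.fv])) d

theorem SOTerm.vars_finite {n : ℕ} (T : SOTerm L n) : T.vars.Finite := by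
  cases T <;> simp [vars]

/-- Formulas inside a derivation may be open, and each instantiation has to satisfy a guard. The set
`S` collects the variables whose sorts are needed for this; it is finite so that the assumptions can
later be removed one by one. -/
theorem SOL.sorted {Γ : Set (SOFormula L)} {A : SOFormula L} (h : SOL Γ A) :
    ∃ S : Set SOVar, S.Finite ∧ FOL (sortedContext Γ S) A.dagger := by
  induction h with
  | assume h => exact ⟨∅, Set.finite_empty, .assume (Or.inl (Or.inl ⟨_, h, rfl⟩))⟩
  | weaken h d ih =>
    obtain ⟨S, hS, ih⟩ := ih
    exact ⟨S, hS, .weaken (sortedContext_mono h subset_rfl) ih⟩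
  | compr h =>
    refine ⟨∅, Set.finite_empty, .of_mem_G (.compr _ h) ?_⟩
    rw [SOFormula.fv_dagger, SOFormula.fv_of_mem_comprehension h]
  | andI d e ihd ihe =>
    obtain ⟨S, hS, ihd⟩ := ihd
    obtain ⟨T, hT, ihe⟩ := ihe
    exact ⟨S ∪ T, hS.union hT,
      .andI (.weaken (sortedContext_mono subset_rfl Set.subset_union_left) ihd)
      (.weaken (sortedContext_mono subset_rfl Set.subset_union_right) ihe)⟩
  | andE₁ d ih =>
    obtain ⟨S, hS, ih⟩ := ih
    exact ⟨S, hS, .andE₁ ih⟩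
  | andE₂ d ih =>
    obtain ⟨S, hS, ih⟩ := ih
    exact ⟨S, hS, .andE₂ ih⟩
  | orI₁ d ih =>
    obtain ⟨S, hS, ih⟩ := ih
    exact ⟨S, hS, .orI₁ ih⟩
  | orI₂ d ih =>
    obtain ⟨S, hS, ih⟩ := ih
    exact ⟨S, hS, .orI₂ ih⟩
  | orE d e₁ e₂ ih ih₁ ih₂ =>
    obtain ⟨S, hS, ih⟩ := ih
    obtain ⟨S₁, hS₁, ih₁⟩ := ih₁
    obtain ⟨S₂, hS₂, ih₂⟩ := ih₂
    refine ⟨S ∪ (S₁ ∪ S₂), hS.union (hS₁.union hS₂),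
      .orE (.weaken (sortedContext_mono subset_rfl Set.subset_union_left) ih) ?_ ?_⟩ <;>
    rw [← sortedContext_insert]
    · exact .weaken (sortedContext_mono subset_rfl (by grind)) ih₁
    · exact .weaken (sortedContext_mono subset_rfl (by grind)) ih₂
  | impI d ih =>
    obtain ⟨S, hS, ih⟩ := ih
    rw [sortedContext_insert] at ih
    exact ⟨S, hS, .impI ih⟩
  | impE d e ihd ihe =>
    obtain ⟨S, hS, ihd⟩ := ihd
    obtain ⟨T, hT, ihe⟩ := ihe
    exact ⟨S ∪ T, hS.union hT,
      .impE (.weaken (sortedContext_mono subset_rfl Set.subset_union_left) ihd)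
      (.weaken (sortedContext_mono subset_rfl Set.subset_union_right) ihe)⟩
  | botE d ih =>
    obtain ⟨S, hS, ih⟩ := ih
    exact ⟨S, hS, .botE ih.bot_of_dagger⟩
  | @raa Γ A d ih =>
    obtain ⟨S, hS, ih⟩ := ih
    refine ⟨S, hS, .raa ?_⟩
    have ih' := ih.bot_of_dagger
    rw [sortedContext_insert] at ih'
    -- The induction hypothesis assumes `A† → ⊥†`, whereas `raa` supplies `A† → ⊥`; the former
    -- follows from the latter by ex falso.
    refine .impE (.weaken (Set.subset_insert _ _) (.impI ih')) (.impI (.botE ?_))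
    exact .impE (.assume (Or.inr (Or.inl rfl))) (.assume (Or.inl rfl))
  | @allI Γ A v hv d ih =>
    obtain ⟨S, hS, ih⟩ := ih
    -- The sort assumption on `v` would violate the eigenvariable condition, but it is discharged
    -- first, as the guard.
    exact ⟨S \ {v}, hS.sdiff, .allI (notMem_fv_of_mem_sortedContext hv (by simp))
      (.impI (.weaken (sortedContext_subset_insert_sortOf Γ S v) ih))⟩
  | @allE Γ A x t ht d ih =>
    obtain ⟨S, hS, ih⟩ := ih
    refine ⟨S ∪ SOVar.ind '' t.vars, hS.union (t.vars_finite.image _), ?_⟩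
    have e := FOL.allE (A := .imp (sortOf (.ind x)) A.dagger) (t := t.dagger)
      ⟨freeFor_sortOf _ _ _, ht.dagger⟩ ih
    rw [SOFormula.dagger_subst]
    refine .impE (.weaken (sortedContext_mono subset_rfl Set.subset_union_left) e) ?_
    convert FOL.isV_dagger t Set.subset_union_right using 1
    simp [sortOf, isV, Formula.subst, Term.subst]
  | @exI Γ A x t ht d ih =>
    obtain ⟨S, hS, ih⟩ := ih
    refine ⟨S ∪ SOVar.ind '' t.vars, hS.union (t.vars_finite.image _), ?_⟩
    refine FOL.exI (t := t.dagger) ⟨freeFor_sortOf _ _ _, ht.dagger⟩ (.andI ?_ ?_)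
    · convert FOL.isV_dagger t Set.subset_union_right using 1
      simp [sortOf, isV, Formula.subst, Term.subst]
    · rw [← SOFormula.dagger_subst]
      exact .weaken (sortedContext_mono subset_rfl Set.subset_union_left) ih
  | @allE₂ Γ A n X T hT d ih =>
    obtain ⟨S, hS, ih⟩ := ih
    refine ⟨S ∪ T.vars, hS.union T.vars_finite, ?_⟩
    have e := FOL.allE (A := .imp (sortOf (.pred n X)) A.dagger) (t := T.dagger)
      ⟨freeFor_sortOf _ _ _, hT.dagger⟩ ih
    rw [SOFormula.dagger_subst₂]
    refine .impE (.weaken (sortedContext_mono subset_rfl Set.subset_union_left) e) ?_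
    convert FOL.isU_dagger T Set.subset_union_right using 1
    simp [sortOf, isU, Formula.subst, Term.subst]
  | @exI₂ Γ A n X T hT d ih =>
    obtain ⟨S, hS, ih⟩ := ih
    refine ⟨S ∪ T.vars, hS.union T.vars_finite, ?_⟩
    refine FOL.exI (t := T.dagger) ⟨freeFor_sortOf _ _ _, hT.dagger⟩ (.andI ?_ ?_)
    · convert FOL.isU_dagger T Set.subset_union_right using 1
      simp [sortOf, isU, Formula.subst, Term.subst]
    · rw [← SOFormula.dagger_subst₂]
      exact .weaken (sortedContext_mono subset_rfl Set.subset_union_left) ih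
  | @exE Γ Δ A C v hΔ hv hC d e ihd ihe =>
    obtain ⟨S, hS, ihd⟩ := ihd
    obtain ⟨T, hT, ihe⟩ := ihe
    -- The sort assumption on `v` is dropped from the side context, as it comes back as the first
    -- conjunct of the translated existential.
    refine ⟨S ∪ T, hS.union hT, .exE (Δ := sortedContext Δ (T \ {v}))
      (sortedContext_mono hΔ (Set.sdiff_subset.trans Set.subset_union_right))
      (notMem_fv_of_mem_sortedContext hv (by simp)) (by rwa [SOFormula.fv_dagger])
      (.weaken (sortedContext_mono subset_rfl Set.subset_union_left) ihd) ?_⟩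
    rw [sortedContext_insert] at ihe
    have h := (FOL.impI ihe).weaken (sortedContext_subset_insert_sortOf Δ T v)
    have a : FOL (insert (.and (sortOf v) A.dagger) (sortedContext Δ (T \ {v})))
        (.and (sortOf v) A.dagger) := .assume (Set.mem_insert _ _)
    exact .impE (.impE (.weaken (Set.subset_insert _ _) (.impI h)) a.andE₁) a.andE₂

/-- Each `sortOf v` is discharged by `exE` from the nonemptiness of its sort: `v` is not free in the
closed formulas `A`, `Γ†`, `G`, nor in the sort assumptions on other variables. -/
theorem FOL.drop_sorts {Γ : Set (SOFormula L)} {A : DFormula L} (hΓ : ∀ B ∈ Γ, B.IsSentence)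
    (hA : A.fv = ∅) {S : Set SOVar} (hS : S.Finite) (d : FOL (sortedContext Γ S) A) :
    FOL (sortedContext Γ ∅) A := by
  induction S, hS using Set.Finite.induction_on with
  | empty => exact d
  | @insert v S hv hS ih =>
    refine ih (.exE subset_rfl (notMem_fv_of_mem_sortedContext (v := v) ?_ hv) (by simp [hA])
      (FOL.exists_sortOf v) (d.weaken ?_))
    · intro B hB
      rw [hΓ B hB]
      simp
    · rw [sortedContext, Set.image_insert_eq, Set.union_insert]
      rfl

theorem SOL.dagger {Γ : Set (SOFormula L)} {A : SOFormula L} (hΓ : ∀ B ∈ Γ, B.IsSentence)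
    (hA : A.IsSentence) (h : SOL Γ A) : FOL (SOFormula.dagger '' Γ ∪ G L) A.dagger := by
  obtain ⟨S, hS, d⟩ := h.sorted
  have := d.drop_sorts hΓ (by rw [SOFormula.fv_dagger]; exact hA) hS
  simpa [sortedContext] using this

end Derivations

/-! ## Compactness and renaming of variables in second-order logic -/

section Compactness

variable {L : Signature.{u}}

/-- Eigenvariable conditions survive the passage to fewer assumptions. Finiteness is needed in
`SOL.of_double`, where only finitely many indices can be renamed back. -/
theorem SOL.exists_finite {Γ : Set (SOFormula L)} {A : SOFormula L} (h : SOL Γ A) :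
    ∃ Δ ⊆ Γ, Δ.Finite ∧ SOL Δ A := by
  have of_insert : ∀ {Γ : Set (SOFormula L)} {A C : SOFormula L},
      (∃ Δ ⊆ insert A Γ, Δ.Finite ∧ SOL Δ C) → ∃ Δ ⊆ Γ, Δ.Finite ∧ SOL (insert A Δ) C := by
    rintro Γ A C ⟨Δ, hΔ, hf, d⟩
    refine ⟨Δ \ {A}, ?_, hf.sdiff, d.weaken ?_⟩
    · rintro B ⟨hB, hB'⟩
      exact (hΔ hB).resolve_left hB'
    · intro B hB
      by_cases e : B = A
      · exact Or.inl e
      · exact Or.inr ⟨hB, e⟩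
  have map : ∀ {Γ : Set (SOFormula L)} {A C : SOFormula L}, (∀ {Δ}, SOL Δ A → Δ ⊆ Γ → SOL Δ C) →
      (∃ Δ ⊆ Γ, Δ.Finite ∧ SOL Δ A) → ∃ Δ ⊆ Γ, Δ.Finite ∧ SOL Δ C :=
    fun f ⟨Δ, hΔ, hf, d⟩ => ⟨Δ, hΔ, hf, f d hΔ⟩
  induction h with
  | @assume Γ A h => exact ⟨{A}, by simpa using h, Set.finite_singleton _, .assume rfl⟩
  | weaken h d ih =>
    obtain ⟨Δ, hΔ, hf, d⟩ := ih
    exact ⟨Δ, hΔ.trans h, hf, d⟩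
  | compr h => exact ⟨∅, Set.empty_subset _, Set.finite_empty, .compr h⟩
  | andI d e ihd ihe =>
    obtain ⟨Δ, hΔ, hf, d⟩ := ihd
    obtain ⟨Θ, hΘ, hg, e⟩ := ihe
    exact ⟨Δ ∪ Θ, Set.union_subset hΔ hΘ, hf.union hg, .andI (d.weaken Set.subset_union_left)
      (e.weaken Set.subset_union_right)⟩
  | andE₁ d ih => exact map (fun d _ => .andE₁ d) ih
  | andE₂ d ih => exact map (fun d _ => .andE₂ d) ih
  | orI₁ d ih => exact map (fun d _ => .orI₁ d) ih
  | orI₂ d ih => exact map (fun d _ => .orI₂ d) ih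
  | orE d e₁ e₂ ih ih₁ ih₂ =>
    obtain ⟨Δ, hΔ, hf, d⟩ := ih
    obtain ⟨Δ₁, hΔ₁, hf₁, d₁⟩ := of_insert ih₁
    obtain ⟨Δ₂, hΔ₂, hf₂, d₂⟩ := of_insert ih₂
    exact ⟨Δ ∪ (Δ₁ ∪ Δ₂), Set.union_subset hΔ (Set.union_subset hΔ₁ hΔ₂),
      hf.union (hf₁.union hf₂), .orE (d.weaken Set.subset_union_left)
        (d₁.weaken (Set.insert_subset_insert (by grind)))
        (d₂.weaken (Set.insert_subset_insert (by grind)))⟩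
  | impI d ih =>
    obtain ⟨Δ, hΔ, hf, d⟩ := of_insert ih
    exact ⟨Δ, hΔ, hf, .impI d⟩
  | impE d e ihd ihe =>
    obtain ⟨Δ, hΔ, hf, d⟩ := ihd
    obtain ⟨Θ, hΘ, hg, e⟩ := ihe
    exact ⟨Δ ∪ Θ, Set.union_subset hΔ hΘ, hf.union hg, .impE (d.weaken Set.subset_union_left)
      (e.weaken Set.subset_union_right)⟩
  | botE d ih => exact map (fun d _ => .botE d) ih
  | raa d ih =>
    obtain ⟨Δ, hΔ, hf, d⟩ := of_insert ih
    exact ⟨Δ, hΔ, hf, .raa d⟩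
  | allI hv d ih => exact map (fun d h => .allI (fun B hB => hv B (h hB)) d) ih
  | allE ht d ih => exact map (fun d _ => .allE ht d) ih
  | exI ht d ih => exact map (fun d _ => .exI ht d) ih
  | allE₂ hT d ih => exact map (fun d _ => .allE₂ hT d) ih
  | exI₂ hT d ih => exact map (fun d _ => .exI₂ hT d) ih
  | exE hΔ hv hC d e ihd ihe =>
    obtain ⟨Δ₁, hΔ₁, hf₁, d⟩ := ihd
    obtain ⟨Δ₂, hΔ₂, hf₂, e⟩ := of_insert ihe
    exact ⟨Δ₁ ∪ Δ₂, Set.union_subset hΔ₁ (hΔ₂.trans hΔ), hf₁.union hf₂,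
      .exE Set.subset_union_right (fun B hB => hv B (hΔ₂ hB)) hC
        (d.weaken Set.subset_union_left) e⟩

end Compactness

/-! ### Injective renamings of variables -/

section Rename

variable {L : Signature.{u}} {π : ℕ → ℕ}

/-- Renaming the variables of a term. -/
def Term.rename (π : ℕ → ℕ) : Term L ℕ → Term L ℕ
  | var x => var (π x)
  | app f ts => app f fun i => (ts i).rename π

/-- Renaming the index of a variable. -/
def SOVar.rename (π : ℕ → ℕ) : SOVar → SOVar
  | ind x => ind (π x)
  | pred n X => pred n (π X)

/-- Renaming the variable of a second-order term. -/
def SOTerm.rename (π : ℕ → ℕ) : {n : ℕ} → SOTerm L n → SOTerm L n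
  | _, pvar n X => pvar n (π X)
  | _, rel R => rel R
  | _, bot => bot

/-- Renaming all variables of a formula, free and bound. -/
def SOFormula.rename (π : ℕ → ℕ) : SOFormula L → SOFormula L
  | bot => bot
  | rel R ts => rel R fun i => (ts i).rename π
  | pvar n X ts => pvar n (π X) fun i => (ts i).rename π
  | and A B => and (A.rename π) (B.rename π)
  | or A B => or (A.rename π) (B.rename π)
  | imp A B => imp (A.rename π) (B.rename π)
  | all v A => all (v.rename π) (A.rename π)
  | ex v A => ex (v.rename π) (A.rename π)

theorem SOVar.rename_injective (hπ : Function.Injective π) :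
    Function.Injective (SOVar.rename π) := by
  intro v w h
  cases v <;> cases w <;> simp_all [SOVar.rename, hπ.eq_iff]

theorem Term.vars_rename (t : Term L ℕ) : (t.rename π).vars = π '' t.vars := by
  induction t with
  | var x => simp [rename, vars]
  | app f ts ih => simp only [rename, vars, Set.image_iUnion, ih]

theorem Term.ind_vars_rename (t : Term L ℕ) :
    SOVar.ind '' (t.rename π).vars = SOVar.rename π '' (SOVar.ind '' t.vars) := by
  rw [vars_rename, Set.image_image, Set.image_image]
  rfl

theorem SOTerm.vars_rename {n : ℕ} (T : SOTerm L n) :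
    (T.rename π).vars = SOVar.rename π '' T.vars := by
  cases T <;> simp [rename, vars, SOVar.rename]

theorem SOFormula.fv_rename (hπ : Function.Injective π) (A : SOFormula L) :
    (A.rename π).fv = SOVar.rename π '' A.fv := by
  induction A with
  | bot => simp [rename, fv]
  | rel R ts => simp only [rename, fv, Term.ind_vars_rename, Set.image_iUnion]
  | pvar n X ts =>
    simp only [rename, fv, Term.ind_vars_rename, Set.image_iUnion, Set.image_union,
      Set.image_singleton, SOVar.rename]
  | and A B ihA ihB | or A B ihA ihB | imp A B ihA ihB =>
    simp only [rename, fv, Set.image_union, ihA, ihB]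
  | all v A ih | ex v A ih =>
    simp only [rename, fv, ih, Set.image_sdiff (SOVar.rename_injective hπ), Set.image_singleton]

theorem SOFormula.rename_mem_fv (hπ : Function.Injective π) {A : SOFormula L} {v : SOVar} :
    v.rename π ∈ (A.rename π).fv ↔ v ∈ A.fv := by
  rw [fv_rename hπ, (SOVar.rename_injective hπ).mem_set_image]

theorem Term.rename_subst (hπ : Function.Injective π) (s : Term L ℕ) (x : ℕ) (t : Term L ℕ) :
    (s.subst x t).rename π = (s.rename π).subst (π x) (t.rename π) := by
  induction s with
  | var y => by_cases h : y = x <;> simp [subst, rename, h, hπ.eq_iff]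
  | app f ts ih => simp only [subst, rename, ih]

theorem SOFormula.rename_subst (hπ : Function.Injective π) (A : SOFormula L) (x : ℕ)
    (t : Term L ℕ) : (A.subst x t).rename π = (A.rename π).subst (π x) (t.rename π) := by
  induction A with
  | bot => rfl
  | rel R ts | pvar n X ts => simp only [subst, rename, Term.rename_subst hπ]
  | and A B ihA ihB | or A B ihA ihB | imp A B ihA ihB => simp only [subst, rename, ihA, ihB]
  | all v A ih | ex v A ih =>
    have : v.rename π = .ind (π x) ↔ v = .ind x :=
      (SOVar.rename_injective hπ).eq_iff (b := .ind x)
    by_cases h : v = .ind x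
    · simp [subst, rename, h, SOVar.rename]
    · simp [subst, rename, h, this, ih]

theorem SOFormula.FreeFor.rename (hπ : Function.Injective π) {A : SOFormula L} {x : ℕ}
    {t : Term L ℕ} (h : A.FreeFor x t) : (A.rename π).FreeFor (π x) (t.rename π) := by
  induction A with
  | bot | rel R ts | pvar n X ts => trivial
  | and A B ihA ihB | or A B ihA ihB | imp A B ihA ihB => exact ⟨ihA h.1, ihB h.2⟩
  | all v A ih | ex v A ih =>
    rcases h with h | ⟨hv, h⟩
    · exact Or.inl fun h' => h ((rename_mem_fv hπ (v := .ind x)).1 h')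
    · refine Or.inr ⟨?_, ih h⟩
      rwa [Term.ind_vars_rename, (SOVar.rename_injective hπ).mem_set_image]

theorem SOTerm.rename_atom {n : ℕ} (T : SOTerm L n) (ts : Fin n → Term L ℕ) :
    (T.atom ts).rename π = (T.rename π).atom fun i => (ts i).rename π := by
  cases T <;> rfl

theorem SOFormula.rename_subst₂ (hπ : Function.Injective π) (A : SOFormula L) {n : ℕ} (X : ℕ)
    (T : SOTerm L n) : (A.subst₂ n X T).rename π = (A.rename π).subst₂ n (π X) (T.rename π) := by
  induction A with
  | bot | rel R ts => rfl
  | pvar m Y ts =>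
    by_cases h : m = n ∧ Y = X
    · obtain ⟨rfl, rfl⟩ := h
      simp [subst₂, rename, SOTerm.rename_atom]
    · simp [subst₂, rename, h, hπ.eq_iff]
  | and A B ihA ihB | or A B ihA ihB | imp A B ihA ihB => simp only [subst₂, rename, ihA, ihB]
  | all v A ih | ex v A ih =>
    have : v.rename π = .pred n (π X) ↔ v = .pred n X :=
      (SOVar.rename_injective hπ).eq_iff (b := .pred n X)
    by_cases h : v = .pred n X
    · simp [subst₂, rename, h, SOVar.rename]
    · simp [subst₂, rename, h, this, ih]

theorem SOFormula.FreeFor₂.rename (hπ : Function.Injective π) {A : SOFormula L} {n X : ℕ}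
    {T : SOTerm L n} (h : A.FreeFor₂ n X T) : (A.rename π).FreeFor₂ n (π X) (T.rename π) := by
  induction A with
  | bot | rel R ts | pvar n X ts => trivial
  | and A B ihA ihB | or A B ihA ihB | imp A B ihA ihB => exact ⟨ihA h.1, ihB h.2⟩
  | all v A ih | ex v A ih =>
    rcases h with h | ⟨hv, h⟩
    · exact Or.inl fun h' => h ((rename_mem_fv hπ (v := .pred n X)).1 h')
    · refine Or.inr ⟨?_, ih h⟩
      rwa [SOTerm.vars_rename, (SOVar.rename_injective hπ).mem_set_image]

theorem SOFormula.rename_allList (vs : List SOVar) (A : SOFormula L) :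
    (allList vs A).rename π = allList (vs.map (SOVar.rename π)) (A.rename π) := by
  induction vs with
  | nil => rfl
  | cons v vs ih => exact congrArg (all _) ih

theorem SOFormula.rename_mem_comprehension (hπ : Function.Injective π) {A : SOFormula L}
    (h : A ∈ Comprehension L) : A.rename π ∈ Comprehension L := by
  obtain ⟨n, X, x, ψ, hx, hX, vs, nd, hvs, rfl⟩ := h
  refine ⟨n, π X, π ∘ x, ψ.rename π, hπ.comp hx, fun h => hX ((rename_mem_fv hπ).1 h),
    vs.map (SOVar.rename π), nd.map (SOVar.rename_injective hπ), ?_, ?_⟩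
  all_goals
    have e : (comprehension n X x ψ).rename π = comprehension n (π X) (π ∘ x) (ψ.rename π) := by
      simp only [comprehension, rename, rename_allList, iff, List.map_ofFn]
      rfl
  · intro v
    rw [← e, fv_rename hπ]
    simp only [List.mem_map, hvs]
    rfl
  · rw [rename_allList, e]

/-- Injectivity preserves every side condition: eigenvariables, freeness for substitution, and the
distinctness and freshness required in comprehension. -/
theorem SOL.rename (hπ : Function.Injective π) {Γ : Set (SOFormula L)} {A : SOFormula L}
    (h : SOL Γ A) : SOL (SOFormula.rename π '' Γ) (A.rename π) := by
  have eigen : ∀ {Γ : Set (SOFormula L)} {v : SOVar}, (∀ B ∈ Γ, v ∉ B.fv) →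
      ∀ B ∈ SOFormula.rename π '' Γ, v.rename π ∉ B.fv := by
    rintro Γ v h _ ⟨B, hB, rfl⟩
    rw [SOFormula.rename_mem_fv hπ]
    exact h B hB
  induction h with
  | assume h => exact .assume ⟨_, h, rfl⟩
  | weaken h d ih => exact .weaken (Set.image_mono h) ih
  | compr h => exact .compr (SOFormula.rename_mem_comprehension hπ h)
  | andI d e ihd ihe => exact .andI ihd ihe
  | andE₁ d ih => exact .andE₁ ih
  | andE₂ d ih => exact .andE₂ ih
  | orI₁ d ih => exact .orI₁ ih
  | orI₂ d ih => exact .orI₂ ih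
  | orE d e₁ e₂ ih ih₁ ih₂ =>
    rw [Set.image_insert_eq] at ih₁ ih₂
    exact .orE ih ih₁ ih₂
  | impI d ih =>
    rw [Set.image_insert_eq] at ih
    exact .impI ih
  | impE d e ihd ihe => exact .impE ihd ihe
  | botE d ih => exact .botE ih
  | raa d ih =>
    rw [Set.image_insert_eq] at ih
    exact .raa ih
  | allI hv d ih => exact .allI (eigen hv) ih
  | allE ht d ih =>
    rw [SOFormula.rename_subst hπ]
    exact .allE (ht.rename hπ) ih
  | exI ht d ih =>
    rw [SOFormula.rename_subst hπ] at ih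
    exact .exI (ht.rename hπ) ih
  | allE₂ hT d ih =>
    rw [SOFormula.rename_subst₂ hπ]
    exact .allE₂ (hT.rename hπ) ih
  | exI₂ hT d ih =>
    rw [SOFormula.rename_subst₂ hπ] at ih
    exact .exI₂ (hT.rename hπ) ih
  | exE hΔ hv hC d e ihd ihe =>
    rw [Set.image_insert_eq] at ihe
    exact .exE (Set.image_mono hΔ) (eigen hv) (fun h => hC ((SOFormula.rename_mem_fv hπ).1 h))
      ihd ihe

theorem Term.rename_rename (π' : ℕ → ℕ) (t : Term L ℕ) :
    (t.rename π).rename π' = t.rename (π' ∘ π) := by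
  induction t with
  | var x => rfl
  | app f ts ih => simp only [rename, ih]

theorem SOVar.rename_rename (π' : ℕ → ℕ) (v : SOVar) :
    (v.rename π).rename π' = v.rename (π' ∘ π) := by
  cases v <;> rfl

theorem SOFormula.rename_rename (π' : ℕ → ℕ) (A : SOFormula L) :
    (A.rename π).rename π' = A.rename (π' ∘ π) := by
  induction A with
  | bot => rfl
  | rel R ts | pvar n X ts => simp only [rename, Term.rename_rename, Function.comp]
  | and A B ihA ihB | or A B ihA ihB | imp A B ihA ihB => simp only [rename, ihA, ihB]
  | all v A ih | ex v A ih => simp only [rename, ih, SOVar.rename_rename]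

theorem Term.exists_rename_eq_self (t : Term L ℕ) :
    ∃ N, ∀ π : ℕ → ℕ, (∀ k < N, π k = k) → t.rename π = t := by
  induction t with
  | var x => exact ⟨x + 1, fun π h => congrArg var (h x (Nat.lt_succ_self x))⟩
  | app f ts ih =>
    choose N hN using ih
    refine ⟨Finset.univ.sup N, fun π h => congrArg (app f) (funext fun i => hN i π fun k hk => ?_)⟩
    exact h k (hk.trans_le (Finset.le_sup (Finset.mem_univ i)))

theorem Term.exists_rename_eq_self_family {n : ℕ} (ts : Fin n → Term L ℕ) :
    ∃ N, ∀ π : ℕ → ℕ, (∀ k < N, π k = k) → ∀ i, (ts i).rename π = ts i := by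
  choose N hN using fun i => (ts i).exists_rename_eq_self
  exact ⟨Finset.univ.sup N, fun π h i => hN i π fun k hk =>
    h k (hk.trans_le (Finset.le_sup (Finset.mem_univ i)))⟩

theorem SOVar.exists_rename_eq_self (v : SOVar) :
    ∃ N, ∀ π : ℕ → ℕ, (∀ k < N, π k = k) → v.rename π = v := by
  cases v with
  | ind x => exact ⟨x + 1, fun π h => congrArg ind (h x (Nat.lt_succ_self x))⟩
  | pred n X => exact ⟨X + 1, fun π h => congrArg (pred n) (h X (Nat.lt_succ_self X))⟩

/-- `N` exceeds the indices of all variables of the formula, of both kinds, free or bound. -/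
theorem SOFormula.exists_rename_eq_self (A : SOFormula L) :
    ∃ N, ∀ π : ℕ → ℕ, (∀ k < N, π k = k) → A.rename π = A := by
  induction A with
  | bot => exact ⟨0, fun _ _ => rfl⟩
  | rel R ts =>
    obtain ⟨N, hN⟩ := Term.exists_rename_eq_self_family ts
    exact ⟨N, fun π h => congrArg (rel R) (funext (hN π h))⟩
  | pvar n X ts =>
    obtain ⟨N, hN⟩ := Term.exists_rename_eq_self_family ts
    refine ⟨max N (X + 1), fun π h => ?_⟩
    rw [rename, h X (by omega), funext (hN π fun k hk => h k (by omega))]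
  | and A B ihA ihB | or A B ihA ihB | imp A B ihA ihB =>
    obtain ⟨N, hN⟩ := ihA
    obtain ⟨M, hM⟩ := ihB
    refine ⟨max N M, fun π h => ?_⟩
    rw [rename, hN π fun k hk => h k (hk.trans_le (le_max_left _ _)),
      hM π fun k hk => h k (hk.trans_le (le_max_right _ _))]
  | all v A ih | ex v A ih =>
    obtain ⟨N, hN⟩ := v.exists_rename_eq_self
    obtain ⟨M, hM⟩ := ih
    refine ⟨max N M, fun π h => ?_⟩
    rw [rename, hN π fun k hk => h k (hk.trans_le (le_max_left _ _)),
      hM π fun k hk => h k (hk.trans_le (le_max_right _ _))]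

/-- If `Γ` proves `A` after doubling all indices of variables, then `Γ` proves `A`. -/
theorem SOL.of_double {Γ : Set (SOFormula L)} {A : SOFormula L}
    (h : SOL (SOFormula.rename (2 * ·) '' Γ) (A.rename (2 * ·))) : SOL Γ A := by
  obtain ⟨Δ, hΔ, hf, d⟩ := h.exists_finite
  obtain ⟨Θ, hΘ, hg, rfl⟩ := Set.exists_subset_image_finite_and.1 ⟨Δ, hΔ, hf, rfl⟩
  choose N hN using SOFormula.exists_rename_eq_self (L := L)
  obtain ⟨M, hM⟩ := ((hg.insert A).image N).bddAbove
  -- Halving all even numbers already exhausts `ℕ`, so no injection inverts doubling everywhere.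
  -- Halving only those below `2 * M` gives values below `M`, and every other number is shifted to
  -- at least `M`.
  let π : ℕ → ℕ := fun k => if k % 2 = 0 ∧ k < 2 * M then k / 2 else k + M
  have hπ : Function.Injective π := by
    intro a b h
    simp only [π] at h
    split_ifs at h <;> omega
  have key : ∀ B ∈ insert A Θ, (B.rename (2 * ·)).rename π = B := by
    intro B hB
    rw [SOFormula.rename_rename]
    refine hN B _ fun k hk => ?_
    have : N B ≤ M := hM ⟨B, hB, rfl⟩
    have : 2 * k % 2 = 0 ∧ 2 * k < 2 * M := by omega
    simp [π]
    omega
  have e := d.rename hπ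
  rw [key A (Set.mem_insert _ _)] at e
  refine e.weaken ?_
  rintro _ ⟨_, ⟨B, hB, rfl⟩, rfl⟩
  rw [key B (Or.inr hB)]
  exact hΘ hB

end Rename

/-! ## Fresh variables in second-order logic -/

section Occurrences

variable {L : Signature.{u}}

/-- The variables that occur in a formula, free or bound. -/
def SOFormula.occ : SOFormula L → Set SOVar
  | bot => ∅
  | rel _ ts => ⋃ i, SOVar.ind '' (ts i).vars
  | pvar n X ts => {SOVar.pred n X} ∪ ⋃ i, SOVar.ind '' (ts i).vars
  | and A B => A.occ ∪ B.occ
  | or A B => A.occ ∪ B.occ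
  | imp A B => A.occ ∪ B.occ
  | all v A => insert v A.occ
  | ex v A => insert v A.occ

theorem SOFormula.occ_finite (A : SOFormula L) : A.occ.Finite := by
  induction A with
  | bot => exact Set.finite_empty
  | rel R ts => exact Set.finite_iUnion fun i => (ts i).vars_finite.image _
  | pvar n X ts =>
    exact (Set.finite_singleton _).union (Set.finite_iUnion fun i => (ts i).vars_finite.image _)
  | and A B ihA ihB | or A B ihA ihB | imp A B ihA ihB => exact ihA.union ihB
  | all v A ih | ex v A ih => exact ih.insert v

theorem SOFormula.fv_subset_occ (A : SOFormula L) : A.fv ⊆ A.occ := by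
  induction A with
  | bot | rel R ts | pvar n X ts => exact subset_rfl
  | and A B ihA ihB | or A B ihA ihB | imp A B ihA ihB => exact Set.union_subset_union ihA ihB
  | all v A ih | ex v A ih => exact Set.sdiff_subset.trans (ih.trans (Set.subset_insert _ _))

end Occurrences

/-- The second-order terms of all arities together with the individual terms. -/
abbrev Element (L : Signature.{u}) : Type u := Term L ℕ ⊕ Σ n, SOTerm L n

namespace Element

variable {L : Signature.{u}}

/-- The individual term given by an element (a dummy one if the element has another sort). -/
def asTerm : Element L → Term L ℕ
  | .inl t => t
  | .inr _ => .var 0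

/-- The `n`-ary second-order term given by an element (a dummy one if the element has another
sort). -/
def asPred (n : ℕ) : Element L → SOTerm L n
  | .inl _ => .pvar n 0
  | .inr ⟨m, T⟩ => if h : m = n then h ▸ T else .pvar n 0

@[simp] theorem asTerm_inl (t : Term L ℕ) : asTerm (.inl t) = t := rfl

@[simp] theorem asPred_inr {n : ℕ} (T : SOTerm L n) : asPred n (.inr ⟨n, T⟩) = T := by
  simp [asPred]

/-- An element has the sort of a variable. -/
def HasSort : SOVar → Element L → Prop
  | .ind _, d => ∃ t, d = .inl t
  | .pred n _, d => ∃ T, d = .inr ⟨n, T⟩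

/-- A variable as an element. -/
def ofVar : SOVar → Element L
  | .ind x => .inl (.var x)
  | .pred n X => .inr ⟨n, .pvar n X⟩

/-- Renaming the variables of an element. -/
def rename (π : ℕ → ℕ) : Element L → Element L
  | .inl t => .inl (t.rename π)
  | .inr ⟨n, T⟩ => .inr ⟨n, T.rename π⟩

theorem HasSort.rename {v : SOVar} {d : Element L} (h : HasSort v d) (π : ℕ → ℕ) :
    HasSort v (d.rename π) := by
  cases v with
  | ind x =>
    obtain ⟨t, rfl⟩ := h
    exact ⟨_, rfl⟩
  | pred n X =>
    obtain ⟨T, rfl⟩ := h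
    exact ⟨_, rfl⟩

theorem rename_ofVar (π : ℕ → ℕ) (v : SOVar) :
    (ofVar v : Element L).rename π = ofVar (v.rename π) := by
  cases v <;> rfl

theorem hasSort_ofVar_rename (π : ℕ → ℕ) (v : SOVar) :
    HasSort v (ofVar (v.rename π) : Element L) := by
  cases v <;> exact ⟨_, rfl⟩

end Element

/-! ### Substitution of fresh variables and the derived quantifier rules -/

section FreshVariables

variable {L : Signature.{u}}

/-- Substitution of an element for a variable of either kind. -/
def SOFormula.substElement (A : SOFormula L) (v : SOVar) (d : Element L) : SOFormula L :=
  match v with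
  | .ind x => A.subst x d.asTerm
  | .pred n X => A.subst₂ n X (d.asPred n)

/-- An element is free for a variable of either kind. -/
def SOFormula.FreeForElement (A : SOFormula L) (v : SOVar) (d : Element L) : Prop :=
  match v with
  | .ind x => A.FreeFor x d.asTerm
  | .pred n X => A.FreeFor₂ n X (d.asPred n)

theorem SOL.allElim {Γ : Set (SOFormula L)} {A : SOFormula L} {v : SOVar} {d : Element L}
    (hd : A.FreeForElement v d) (h : SOL Γ (.all v A)) : SOL Γ (A.substElement v d) := by
  cases v with
  | ind x => exact .allE hd h
  | pred n X => exact .allE₂ hd h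

theorem SOL.exIntro {Γ : Set (SOFormula L)} {A : SOFormula L} {v : SOVar} {d : Element L}
    (hd : A.FreeForElement v d) (h : SOL Γ (A.substElement v d)) : SOL Γ (.ex v A) := by
  cases v with
  | ind x => exact .exI hd h
  | pred n X => exact .exI₂ hd h

theorem Term.subst_subst_of_notMem {s : Term L ℕ} {x y : ℕ} (h : y ∉ s.vars) :
    (s.subst x (.var y)).subst y (.var x) = s := by
  induction s with
  | var z =>
    have hz : z ≠ y := fun e => h (by simp [vars, e])
    by_cases e : z = x <;> simp [subst, e, hz]
  | app f ts ih =>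
    simp only [vars, Set.mem_iUnion, not_exists] at h
    simp only [subst]
    exact congrArg _ (funext fun i => ih i (h i))

theorem Term.notMem_vars_subst {s : Term L ℕ} {x y : ℕ} (h : x ≠ y) :
    x ∉ (s.subst x (.var y)).vars := by
  induction s with
  | var z => by_cases e : z = x <;> simp [subst, vars, e, h, Ne.symm]
  | app f ts ih => simpa [subst, vars] using ih

theorem SOFormula.notMem_fv_subst (A : SOFormula L) {x y : ℕ} (h : x ≠ y) :
    .ind x ∉ (A.subst x (.var y)).fv := by
  induction A with
  | bot => simp [subst, fv]
  | rel R ts | pvar n X ts =>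
    simp [subst, fv, Term.notMem_vars_subst h]
  | and A B ihA ihB | or A B ihA ihB | imp A B ihA ihB => simp [subst, fv, ihA, ihB]
  | all v A ih | ex v A ih => by_cases e : v = .ind x <;> simp [subst, fv, e, ih]

theorem SOFormula.notMem_fv_subst₂ (A : SOFormula L) {n X Y : ℕ} (h : X ≠ Y) :
    .pred n X ∉ (A.subst₂ n X (.pvar n Y)).fv := by
  induction A with
  | bot | rel R ts => simp [subst₂, fv]
  | pvar m Z ts =>
    by_cases e : m = n ∧ Z = X
    · obtain ⟨rfl, rfl⟩ := e
      simp [subst₂, fv, SOTerm.atom, h]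
    · simp only [subst₂, e, dif_neg, not_false_eq_true, fv]
      simp
      exact fun h₁ h₂ => e ⟨h₁.symm, h₂.symm⟩
  | and A B ihA ihB | or A B ihA ihB | imp A B ihA ihB => simp [subst₂, fv, ihA, ihB]
  | all v A ih | ex v A ih => by_cases e : v = .pred n X <;> simp [subst₂, fv, e, ih]

theorem SOFormula.subst_of_notMem {A : SOFormula L} {x : ℕ} (t : Term L ℕ) (h : .ind x ∉ A.fv) :
    A.subst x t = A := by
  induction A with
  | bot => rfl
  | rel R ts | pvar n X ts =>
    simp only [fv, Set.mem_iUnion, Set.mem_union, not_or, not_exists,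
      Set.mem_image, SOVar.ind.injEq, exists_eq_right] at h
    simp only [subst]
    first
    | exact congrArg _ (funext fun i => Term.subst_of_notMem t (h i))
    | exact congrArg _ (funext fun i => Term.subst_of_notMem t (h.2 i))
  | and A B ihA ihB | or A B ihA ihB | imp A B ihA ihB =>
    simp only [fv, Set.mem_union, not_or] at h
    simp only [subst, ihA h.1, ihB h.2]
  | all v A ih | ex v A ih =>
    by_cases e : v = .ind x
    · simp [subst, e]
    · have : .ind x ∉ A.fv := fun hx => h ⟨hx, fun e' => e (Eq.symm e')⟩
      simp [subst, ih this]

theorem SOFormula.subst₂_of_notMem {A : SOFormula L} {n X : ℕ} (T : SOTerm L n)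
    (h : .pred n X ∉ A.fv) : A.subst₂ n X T = A := by
  induction A with
  | bot | rel R ts => rfl
  | pvar m Y ts =>
    have : ¬ (m = n ∧ Y = X) := by
      rintro ⟨rfl, rfl⟩
      exact h (Or.inl rfl)
    simp [subst₂, this]
  | and A B ihA ihB | or A B ihA ihB | imp A B ihA ihB =>
    simp only [fv, Set.mem_union, not_or] at h
    simp only [subst₂, ihA h.1, ihB h.2]
  | all v A ih | ex v A ih =>
    by_cases e : v = .pred n X
    · simp [subst₂, e]
    · have : .pred n X ∉ A.fv := fun hx => h ⟨hx, fun e' => e (Eq.symm e')⟩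
      simp [subst₂, ih this]

/-- Bound occurrences of `y` must be excluded too: a quantifier on `y` would capture the substituted
variable, and the way back would miss it. -/
theorem SOFormula.subst_subst_of_notMem {A : SOFormula L} {x y : ℕ} (h : .ind y ∉ A.occ) :
    (A.subst x (.var y)).subst y (.var x) = A := by
  induction A with
  | bot => rfl
  | rel R ts | pvar n X ts =>
    simp only [occ, Set.mem_iUnion, Set.mem_union, not_or, not_exists,
      Set.mem_image, SOVar.ind.injEq, exists_eq_right] at h
    simp only [subst]
    first
    | exact congrArg _ (funext fun i => Term.subst_subst_of_notMem (h i))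
    | exact congrArg _ (funext fun i => Term.subst_subst_of_notMem (h.2 i))
  | and A B ihA ihB | or A B ihA ihB | imp A B ihA ihB =>
    simp only [occ, Set.mem_union, not_or] at h
    simp only [subst, ihA h.1, ihB h.2]
  | all v A ih | ex v A ih =>
    simp only [occ, Set.mem_insert_iff, not_or] at h
    have hv : v ≠ .ind y := fun e => h.1 e.symm
    by_cases e : v = .ind x
    · have := subst_of_notMem (.var x) fun h' => h.2 (fv_subset_occ A h')
      have hx : x ≠ y := fun e' => hv (e' ▸ e)
      simp [subst, e, hx, this]
    · simp [subst, e, hv, ih h.2]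

theorem SOFormula.subst₂_subst₂_of_notMem {A : SOFormula L} {n X Y : ℕ}
    (h : .pred n Y ∉ A.occ) : (A.subst₂ n X (.pvar n Y)).subst₂ n Y (.pvar n X) = A := by
  induction A with
  | bot | rel R ts => rfl
  | pvar m Z ts =>
    have hZ : ¬ (m = n ∧ Z = Y) := by
      rintro ⟨rfl, rfl⟩
      exact h (Or.inl rfl)
    by_cases e : m = n ∧ Z = X
    · obtain ⟨rfl, rfl⟩ := e
      simp [subst₂, SOTerm.atom]
    · simp [subst₂, e, hZ]
  | and A B ihA ihB | or A B ihA ihB | imp A B ihA ihB =>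
    simp only [occ, Set.mem_union, not_or] at h
    simp only [subst₂, ihA h.1, ihB h.2]
  | all v A ih | ex v A ih =>
    simp only [occ, Set.mem_insert_iff, not_or] at h
    have hv : v ≠ .pred n Y := fun e => h.1 e.symm
    by_cases e : v = .pred n X
    · have := subst₂_of_notMem (.pvar n X) fun h' => h.2 (fv_subset_occ A h')
      have hx : X ≠ Y := fun e' => hv (e' ▸ e)
      simp [subst₂, e, hx, this]
    · simp [subst₂, e, hv, ih h.2]

theorem SOFormula.freeFor_of_notMem_occ {A : SOFormula L} {x y : ℕ} (h : .ind y ∉ A.occ) :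
    A.FreeFor x (.var y) := by
  induction A with
  | bot | rel R ts | pvar n X ts => trivial
  | and A B ihA ihB | or A B ihA ihB | imp A B ihA ihB =>
    exact ⟨ihA fun h' => h (Or.inl h'), ihB fun h' => h (Or.inr h')⟩
  | all v A ih | ex v A ih =>
    simp only [occ, Set.mem_insert_iff, not_or] at h
    exact Or.inr ⟨by simpa [Term.vars] using Ne.symm h.1, ih h.2⟩

theorem SOFormula.freeFor₂_of_notMem_occ {A : SOFormula L} {n X Y : ℕ} (h : .pred n Y ∉ A.occ) :
    A.FreeFor₂ n X (.pvar n Y) := by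
  induction A with
  | bot | rel R ts | pvar n X ts => trivial
  | and A B ihA ihB | or A B ihA ihB | imp A B ihA ihB =>
    exact ⟨ihA fun h' => h (Or.inl h'), ihB fun h' => h (Or.inr h')⟩
  | all v A ih | ex v A ih =>
    simp only [occ, Set.mem_insert_iff, not_or] at h
    exact Or.inr ⟨fun h' => h.1 (Eq.symm h'), ih h.2⟩

theorem SOFormula.freeFor_subst_of_notMem_occ {A : SOFormula L} {x y : ℕ} (h : .ind y ∉ A.occ) :
    (A.subst x (.var y)).FreeFor y (.var x) := by
  induction A with
  | bot | rel R ts | pvar n X ts => trivial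
  | and A B ihA ihB | or A B ihA ihB | imp A B ihA ihB =>
    exact ⟨ihA fun h' => h (Or.inl h'), ihB fun h' => h (Or.inr h')⟩
  | all v A ih | ex v A ih =>
    simp only [occ, Set.mem_insert_iff, not_or] at h
    by_cases e : v = .ind x
    · rw [subst, if_pos e]
      exact Or.inl fun h' => h.2 (fv_subset_occ A h'.1)
    · rw [subst, if_neg e]
      exact Or.inr ⟨by simpa [Term.vars] using e, ih h.2⟩

theorem SOFormula.freeFor₂_subst₂_of_notMem_occ {A : SOFormula L} {n X Y : ℕ}
    (h : .pred n Y ∉ A.occ) : (A.subst₂ n X (.pvar n Y)).FreeFor₂ n Y (.pvar n X) := by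
  induction A with
  | bot | rel R ts => trivial
  | pvar m Z ts =>
    by_cases e : m = n ∧ Z = X
    · obtain ⟨rfl, rfl⟩ := e
      simp [subst₂, SOTerm.atom, FreeFor₂]
    · simp [subst₂, e, FreeFor₂]
  | and A B ihA ihB | or A B ihA ihB | imp A B ihA ihB =>
    exact ⟨ihA fun h' => h (Or.inl h'), ihB fun h' => h (Or.inr h')⟩
  | all v A ih | ex v A ih =>
    simp only [occ, Set.mem_insert_iff, not_or] at h
    by_cases e : v = .pred n X
    · rw [subst₂, if_pos e]
      exact Or.inl fun h' => h.2 (fv_subset_occ A h'.1)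
    · rw [subst₂, if_neg e]
      exact Or.inr ⟨e, ih h.2⟩

/-- Replacing a variable by another one of the same sort that does not occur is reversible. -/
theorem SOFormula.substElement_fresh {A : SOFormula L} {v w : SOVar}
    (hs : Element.HasSort v (.ofVar w : Element L)) (hne : v ≠ w) (h : w ∉ A.occ) :
    A.FreeForElement v (.ofVar w) ∧ v ∉ (A.substElement v (.ofVar w)).fv ∧
      (A.substElement v (.ofVar w)).FreeForElement w (.ofVar v) ∧
      (A.substElement v (.ofVar w)).substElement w (.ofVar v) = A := by
  cases v with
  | ind x =>
    cases w with
    | ind y =>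
      exact ⟨freeFor_of_notMem_occ h, notMem_fv_subst A (by simpa using hne),
        freeFor_subst_of_notMem_occ h, subst_subst_of_notMem h⟩
    | pred m Y =>
      obtain ⟨_, h⟩ := hs
      cases h
  | pred n X =>
    cases w with
    | ind y =>
      obtain ⟨_, h⟩ := hs
      cases h
    | pred m Y =>
      obtain ⟨T, hT⟩ := hs
      obtain ⟨rfl, -⟩ := Sigma.mk.inj (Sum.inr.inj hT)
      simp only [FreeForElement, substElement, Element.ofVar, Element.asPred_inr]
      exact ⟨freeFor₂_of_notMem_occ h, notMem_fv_subst₂ A (by simpa using hne),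
        freeFor₂_subst₂_of_notMem_occ h, subst₂_subst₂_of_notMem h⟩

theorem SOL.allI_fresh {Γ : Set (SOFormula L)} {A : SOFormula L} {v w : SOVar}
    (hs : Element.HasSort v (.ofVar w : Element L)) (hne : v ≠ w) (h : w ∉ A.occ)
    (hΓ : ∀ B ∈ Γ, w ∉ B.fv) (d : SOL Γ (A.substElement v (.ofVar w))) : SOL Γ (.all v A) := by
  obtain ⟨-, h₂, h₃, h₄⟩ := SOFormula.substElement_fresh hs hne h
  -- With this formula as the only assumption `v` may be generalised, even if `v` is free in `Γ`.
  have e : SOL {.all w (A.substElement v (.ofVar w))} (.all v A) := by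
    refine .allI ?_ ?_
    · rintro B rfl hB
      exact h₂ hB.1
    · have := SOL.allElim h₃ (.assume (Set.mem_singleton _))
      rwa [h₄] at this
  exact .impE (.impI (e.weaken (by simp))) (.allI hΓ d)

theorem SOL.exE_fresh {Γ : Set (SOFormula L)} {A C : SOFormula L} {v w : SOVar}
    (hs : Element.HasSort v (.ofVar w : Element L)) (hne : v ≠ w) (h : w ∉ A.occ)
    (hΓ : ∀ B ∈ Γ, w ∉ B.fv) (hC : w ∉ C.fv) (d : SOL Γ (.ex v A))
    (e : SOL (insert (A.substElement v (.ofVar w)) Γ) C) : SOL Γ C := by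
  obtain ⟨-, h₂, h₃, h₄⟩ := SOFormula.substElement_fresh hs hne h
  refine .exE (v := w) (A := A.substElement v (.ofVar w)) subset_rfl hΓ hC ?_ e
  -- Renaming the bound variable needs no side assumptions; the empty side context makes free
  -- occurrences of `v` in `Γ` harmless.
  refine .exE (v := v) (A := A) (Set.empty_subset _) (by simp) (fun h' => h₂ h'.1) d ?_
  refine .exIntro h₃ (.assume ?_)
  rw [h₄]
  exact Set.mem_insert _ _

end FreshVariables

/-! ## Instances of second-order formulas -/

section Instances

variable {L : Signature.{u}}

/-- Simultaneous substitution in a term. -/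
def Term.bind (τ : ℕ → Term L ℕ) : Term L ℕ → Term L ℕ
  | var x => τ x
  | app f ts => app f fun i => (ts i).bind τ

/-- Doubling the index of a variable. -/
abbrev SOVar.double (v : SOVar) : SOVar := v.rename (2 * ·)

/-- `A.inst σ` replaces the free variables of `A` by their values under `σ` and doubles the indices
of the bound variables. -/
def SOFormula.inst : SOFormula L → (SOVar → Element L) → SOFormula L
  | bot, _ => bot
  | rel R ts, σ => rel R fun i => (ts i).bind fun x => (σ (.ind x)).asTerm
  | pvar n X ts, σ =>
      ((σ (.pred n X)).asPred n).atom fun i => (ts i).bind fun x => (σ (.ind x)).asTerm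
  | and A B, σ => and (A.inst σ) (B.inst σ)
  | or A B, σ => or (A.inst σ) (B.inst σ)
  | imp A B, σ => imp (A.inst σ) (B.inst σ)
  | all v A, σ => all v.double (A.inst (Function.update σ v (.ofVar v.double)))
  | ex v A, σ => ex v.double (A.inst (Function.update σ v (.ofVar v.double)))

theorem Term.bind_congr {τ τ' : ℕ → Term L ℕ} {t : Term L ℕ} (h : ∀ x ∈ t.vars, τ x = τ' x) :
    t.bind τ = t.bind τ' := by
  induction t with
  | var x => exact h x rfl
  | app f ts ih =>
    exact congrArg (app f) (funext fun i => ih i fun x hx => h x (Set.mem_iUnion.2 ⟨i, hx⟩))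

theorem SOFormula.inst_congr {A : SOFormula L} {σ σ' : SOVar → Element L}
    (h : ∀ v ∈ A.fv, σ v = σ' v) : A.inst σ = A.inst σ' := by
  induction A generalizing σ σ' with
  | bot => rfl
  | rel R ts =>
    refine congrArg (rel R) (funext fun i => Term.bind_congr fun x hx => ?_)
    rw [h _ (Set.mem_iUnion.2 ⟨i, x, hx, rfl⟩)]
  | pvar n X ts =>
    simp only [inst, h _ (Or.inl rfl)]
    refine congrArg _ (funext fun i => Term.bind_congr fun x hx => ?_)
    rw [h _ (Or.inr (Set.mem_iUnion.2 ⟨i, x, hx, rfl⟩))]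
  | and A B ihA ihB | or A B ihA ihB | imp A B ihA ihB =>
    simp only [inst, ihA fun v hv => h v (Or.inl hv), ihB fun v hv => h v (Or.inr hv)]
  | all v A ih | ex v A ih =>
    simp only [inst]
    refine congrArg _ (ih fun w hw => ?_)
    by_cases e : w = v
    · subst e; simp
    · simpa [e] using h w ⟨hw, e⟩

theorem Term.bind_var (π : ℕ → ℕ) (t : Term L ℕ) : (t.bind fun x => .var (π x)) = t.rename π := by
  induction t with
  | var x => rfl
  | app f ts ih => exact congrArg (app f) (funext ih)

theorem SOFormula.inst_ofVar_double (A : SOFormula L) :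
    A.inst (fun v => .ofVar v.double) = A.rename (2 * ·) := by
  induction A with
  | bot => rfl
  | rel R ts => exact congrArg (rel R) (funext fun i => Term.bind_var _ _)
  | pvar n X ts =>
    simp only [inst, rename, SOVar.double, SOVar.rename, Element.ofVar, Element.asPred_inr]
    exact congrArg (pvar n _) (funext fun i => Term.bind_var _ _)
  | and A B ihA ihB | or A B ihA ihB | imp A B ihA ihB => simp only [inst, rename, ihA, ihB]
  | all v A ih | ex v A ih =>
    have : Function.update (fun v => (Element.ofVar (SOVar.double v) : Element L)) v
        (.ofVar v.double) = fun v => .ofVar v.double :=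
      Function.update_eq_self v fun v => (Element.ofVar (SOVar.double v) : Element L)
    simp only [inst, rename, this, ih]

theorem SOFormula.IsSentence.inst {A : SOFormula L} (h : A.IsSentence) (σ : SOVar → Element L) :
    A.inst σ = A.rename (2 * ·) := by
  rw [← inst_ofVar_double]
  refine inst_congr fun v hv => ?_
  rw [h] at hv
  exact hv.elim

/-- The variables of an element. -/
def Element.vars : Element L → Set SOVar
  | .inl t => SOVar.ind '' t.vars
  | .inr ⟨_, T⟩ => T.vars

/-- An element has the sort of the variable `v`, and it is either the variable with doubled index or
contains no variable with doubled index. -/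
def Element.Tame (v : SOVar) (d : Element L) : Prop :=
  HasSort v d ∧ ((∀ w : SOVar, w.double ∉ d.vars) ∨ d = .ofVar v.double)

theorem Element.tame_ofVar_double (v : SOVar) : Tame v (ofVar v.double : Element L) :=
  ⟨hasSort_ofVar_rename _ v, Or.inr rfl⟩

/-- Parity: renamed indices are odd, doubled ones even. -/
theorem Element.double_notMem_vars_rename (d : Element L) (w : SOVar) :
    w.double ∉ (d.rename (2 * · + 1)).vars := by
  have key : ∀ u : SOVar, u.rename (2 * · + 1) ≠ w.double := by
    intro u e
    cases u <;> cases w <;> simp [SOVar.double, SOVar.rename] at e <;> omega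
  rcases d with t | ⟨n, T⟩
  · simp only [rename, vars, Term.ind_vars_rename]
    rintro ⟨u, -, e⟩
    exact key u e
  · simp only [rename, vars, SOTerm.vars_rename]
    rintro ⟨u, -, e⟩
    exact key u e

theorem Element.HasSort.tame_rename {v : SOVar} {d : Element L} (h : HasSort v d) :
    Tame v (d.rename (2 * · + 1)) :=
  ⟨h.rename _, Or.inl d.double_notMem_vars_rename⟩

theorem Element.tame_update {σ : SOVar → Element L} (hσ : ∀ v, Tame v (σ v)) {v : SOVar}
    {d : Element L} (hd : Tame v d) (w : SOVar) : Tame w (Function.update σ v d w) := by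
  by_cases e : w = v
  · subst e; simpa using hd
  · simpa [e] using hσ w

theorem SOTerm.atom_subst {n : ℕ} (T : SOTerm L n) (ts : Fin n → Term L ℕ) (x : ℕ)
    (t : Term L ℕ) : (T.atom ts).subst x t = T.atom fun i => (ts i).subst x t := by
  cases T <;> rfl

theorem SOTerm.atom_subst₂_of_notMem {m n X : ℕ} {T : SOTerm L m} (h : .pred n X ∉ T.vars)
    (ts : Fin m → Term L ℕ) (U : SOTerm L n) : (T.atom ts).subst₂ n X U = T.atom ts := by
  cases T with
  | pvar m Y =>
    have : ¬ (m = n ∧ Y = X) := by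
      rintro ⟨rfl, rfl⟩
      exact h rfl
    simp [atom, SOFormula.subst₂, this]
  | rel R | bot => rfl

theorem Term.bind_subst {σ : SOVar → Element L} (hσ : ∀ v, (σ v).Tame v) {x : ℕ}
    (hx : σ (.ind x) = .ofVar (SOVar.ind x).double) (d : Element L) (t : Term L ℕ) :
    (t.bind fun y => (σ (.ind y)).asTerm).subst (2 * x) d.asTerm =
      t.bind fun y => (Function.update σ (.ind x) d (.ind y)).asTerm := by
  induction t with
  | var y =>
    by_cases e : y = x
    · subst e
      simp [bind, hx, SOVar.double, SOVar.rename, Element.ofVar, subst]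
    · have e' : SOVar.ind y ≠ .ind x := by simpa using e
      simp only [bind, Function.update_of_ne e']
      obtain ⟨⟨s, hs⟩, h⟩ := hσ (.ind y)
      refine subst_of_notMem _ ?_
      rw [hs] at h ⊢
      rcases h with h | h
      · exact fun hx => h (.ind x) ⟨2 * x, hx, rfl⟩
      · obtain rfl := Sum.inl.inj h
        simpa [vars] using Ne.symm e
  | app f ts ih => exact congrArg (app f) (funext ih)

/-- Tameness ensures that `v.double` enters the instance only as the value at `v`, so replacing it
afterwards amounts to changing `σ` at `v`. This is a purely syntactic identity; absence of capture
is the matter of `inst_freeForElement`. -/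
theorem SOFormula.inst_substElement {A : SOFormula L} {σ : SOVar → Element L}
    (hσ : ∀ v, (σ v).Tame v) {v : SOVar} (hv : σ v = .ofVar v.double) (d : Element L) :
    (A.inst σ).substElement v.double d = A.inst (Function.update σ v d) := by
  have double_inj : ∀ {v w : SOVar}, v.double = w.double ↔ v = w :=
    (SOVar.rename_injective fun a b h => by simpa using h).eq_iff
  -- The hypotheses on `σ` persist under a quantifier on `w ≠ v`, and the two updates commute.
  have step : ∀ {w : SOVar}, w ≠ v → ∀ {σ : SOVar → Element L}, (∀ v, (σ v).Tame v) →
      σ v = .ofVar v.double →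
      (∀ u, (Function.update σ w (.ofVar w.double) u).Tame u) ∧
        Function.update σ w (.ofVar w.double) v = .ofVar v.double ∧
        Function.update (Function.update σ w (.ofVar w.double)) v d =
          Function.update (Function.update σ v d) w (.ofVar w.double) := fun e _ hσ hv =>
    ⟨Element.tame_update hσ (Element.tame_ofVar_double _), by rwa [Function.update_of_ne e.symm],
      Function.update_comm e _ _ _⟩
  cases v with
  | ind x =>
    simp only [SOVar.double, SOVar.rename, substElement]
    induction A generalizing σ with
    | bot => rfl
    | rel R ts => exact congrArg (rel R) (funext fun i => Term.bind_subst hσ hv d (ts i))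
    | pvar n X ts =>
      simp only [inst, SOTerm.atom_subst, Term.bind_subst hσ hv d]
      simp
    | and A B ihA ihB | or A B ihA ihB | imp A B ihA ihB =>
      simp only [inst, subst, ihA hσ hv, ihB hσ hv]
    | all w A ih | ex w A ih =>
      by_cases e : w = .ind x
      · subst e
        simp [inst, subst, SOVar.rename]
      · have e' : w.double ≠ .ind (2 * x) := fun h => e ((double_inj (w := .ind x)).1 h)
        obtain ⟨h₁, h₂, h₃⟩ := step e hσ hv
        simp only [inst, subst, e', if_false, ih h₁ h₂, h₃]
  | pred n X =>
    simp only [SOVar.double, SOVar.rename, substElement]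
    induction A generalizing σ with
    | bot => rfl
    | rel R ts => simp [inst, subst₂]
    | pvar m Y ts =>
      by_cases e : m = n ∧ Y = X
      · obtain ⟨rfl, rfl⟩ := e
        simp [inst, hv, SOVar.double, SOVar.rename, Element.ofVar, SOTerm.atom, subst₂]
      · have e' : SOVar.pred m Y ≠ .pred n X := by simpa using e
        simp only [inst, Function.update_of_ne e']
        rw [SOTerm.atom_subst₂_of_notMem]
        · simp
        · obtain ⟨⟨T, hT⟩, h⟩ := hσ (.pred m Y)
          rw [hT] at h ⊢
          rw [Element.asPred_inr]
          rcases h with h | h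
          · exact h (.pred n X)
          · obtain rfl := eq_of_heq (Sigma.mk.inj (Sum.inr.inj h)).2
            simpa [SOTerm.vars, eq_comm] using e
    | and A B ihA ihB | or A B ihA ihB | imp A B ihA ihB =>
      simp only [inst, subst₂, ihA hσ hv, ihB hσ hv]
    | all w A ih | ex w A ih =>
      by_cases e : w = .pred n X
      · subst e
        simp [inst, subst₂, SOVar.rename]
      · have e' : w.double ≠ .pred n (2 * X) := fun h => e ((double_inj (w := .pred n X)).1 h)
        obtain ⟨h₁, h₂, h₃⟩ := step e hσ hv
        simp only [inst, subst₂, e', if_false, ih h₁ h₂, h₃]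

/-- Every quantifier of an instance binds a doubled variable, and `d` contains none. -/
theorem SOFormula.inst_freeForElement {A : SOFormula L} {σ : SOVar → Element L}
    {v : SOVar} {d : Element L} (hs : d.HasSort v) (hd : ∀ w : SOVar, w.double ∉ d.vars) :
    (A.inst σ).FreeForElement v d := by
  cases v with
  | ind x =>
    obtain ⟨t, rfl⟩ := hs
    induction A generalizing σ with
    | bot | rel R ts => trivial
    | pvar n X ts =>
      simp only [inst, FreeForElement]
      cases (Element.asPred n (σ (.pred n X))) <;> trivial
    | and A B ihA ihB | or A B ihA ihB | imp A B ihA ihB => exact ⟨ihA, ihB⟩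
    | all w A ih | ex w A ih =>
      exact Or.inr ⟨hd w, ih⟩
  | pred n X =>
    obtain ⟨T, rfl⟩ := hs
    induction A generalizing σ with
    | bot | rel R ts => trivial
    | pvar m X ts =>
      simp only [inst, FreeForElement]
      cases (Element.asPred m (σ (.pred m X))) <;> trivial
    | and A B ihA ihB | or A B ihA ihB | imp A B ihA ihB => exact ⟨ihA, ihB⟩
    | all w A ih | ex w A ih =>
      refine Or.inr ⟨?_, ih⟩
      rw [Element.asPred_inr]
      exact hd w

end Instances

/-! ## The term model -/

section TermModel

variable {L : Signature.{u}} (Γ : Set (SOFormula L))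

/-- Derivability from `Γ` and the formulas of a finite set. -/
def Provable (p : {p : Set (SOFormula L) // p.Finite}) (A : SOFormula L) : Prop :=
  SOL (Γ ∪ p.1) A

variable {Γ}

theorem Provable.mono {p q : {p : Set (SOFormula L) // p.Finite}} (h : p ≤ q) {A : SOFormula L}
    (d : Provable Γ p A) : Provable Γ q A :=
  SOL.weaken (Set.union_subset_union_right _ h) d

theorem Provable.iff_insert {p : {p : Set (SOFormula L) // p.Finite}} {A B : SOFormula L} :
    Provable Γ ⟨insert A p.1, p.2.insert A⟩ B ↔ SOL (insert A (Γ ∪ p.1)) B := by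
  rw [Provable, Set.union_insert]

theorem Provable.of_insert {p : {p : Set (SOFormula L) // p.Finite}} {A : SOFormula L} :
    Provable Γ ⟨insert A p.1, p.2.insert A⟩ A := .assume (Or.inr (Or.inl rfl))

/-- Reductio ad absurdum: the world extended by `A.neg` refutes `A`, hence is absurd. Stability of
the term model comes from here. -/
theorem Provable.of_dense {p : {p : Set (SOFormula L) // p.Finite}} {A : SOFormula L}
    (h : ∀ q, p ≤ q → (∀ r, q ≤ r → Provable Γ r A → Provable Γ r .bot) → Provable Γ q .bot) :
    Provable Γ p A := by
  refine .raa (Provable.iff_insert.1 (h _ (Set.subset_insert _ _) fun r hr d => ?_))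
  exact .impE (Provable.of_insert.mono hr) d

variable (Γ)

/-- Interpretation of the relation symbols of the target signature in the term model. -/
def termRel : (R : DaggerRel.{u}) → (Fin (L.dagger.relArity R) → Element L) →
    {p : Set (SOFormula L) // p.Finite} → Prop
  | .Ap n, ds, p =>
      let d : Element L := ds (0 : Fin (n + 1))
      let ts : Fin n → Element L := fun i => ds i.succ
      -- The index `0` is arbitrary, as `HasSort` ignores it. The first disjunct makes the atom hold
      -- throughout the pole, as stability demands.
      Provable Γ p .bot ∨ (d.HasSort (.pred n 0) ∧ ∀ i, (ts i).HasSort (.ind 0)) ∧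
        Provable Γ p (((d.rename (2 * · + 1)).asPred n).atom
          fun i => ((ts i).rename (2 * · + 1)).asTerm)
  | .V, ds, p => Provable Γ p .bot ∨ (ds (0 : Fin 1)).HasSort (.ind 0)
  | .U n, ds, p => Provable Γ p .bot ∨ (ds (0 : Fin 1)).HasSort (.pred n 0)

/-- The term model over a set of second-order formulas. -/
abbrev termModel : ForcingModel L.dagger where
  World := {p : Set (SOFormula L) // p.Finite}
  Dom := Element L
  pole p := Provable Γ p .bot
  pole_mono h := Provable.mono h
  fn
    -- Arguments of the wrong sort are read as a dummy variable, so the value is always an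
    -- individual.
    | .fn f, ds => .inl (.app f fun i => (ds i).asTerm)
    | .cRel R, _ => .inr ⟨_, .rel R⟩
    | .cBot, _ => .inr ⟨0, .bot⟩
  rel := termRel Γ
  rel_mono R ds p q h := by
    cases R with
    | Ap n => exact fun d => d.imp (Provable.mono h) (And.imp_right (Provable.mono h))
    | V | U n => exact fun d => d.imp (Provable.mono h) id
  rel_stable R ds p h := by
    cases R with
    | Ap n =>
      -- Sorts do not depend on the world: if they are wrong, the atom holds only in the pole.
      by_cases hS : (Element.HasSort (.pred n 0) (ds (0 : Fin (n + 1)))) ∧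
          ∀ i : Fin n, (ds i.succ).HasSort (.ind 0)
      · refine Or.inr ⟨hS, Provable.of_dense fun q hq k => h q hq fun r hr d => k r hr ?_⟩
        rcases d with d | d
        · exact .botE d
        · exact d.2
      · exact Or.inl (h p le_rfl fun r _ d => d.resolve_right fun d => hS d.1)
    | V =>
      by_cases hS : (ds (0 : Fin 1)).HasSort (.ind 0)
      · exact Or.inr hS
      · exact Or.inl (h p le_rfl fun r _ d => d.resolve_right hS)
    | U n =>
      by_cases hS : (ds (0 : Fin 1)).HasSort (.pred n 0)
      · exact Or.inr hS
      · exact Or.inl (h p le_rfl fun r _ d => d.resolve_right hS)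

variable {Γ}

theorem forces_ap {n : ℕ} {s : DTerm L} {ts : Fin n → DTerm L} {ρ : SOVar → Element L}
    {p : (termModel Γ).World} :
    (ap n s ts).Forces (termModel Γ) ρ p ↔ Provable Γ p .bot ∨
      (Element.HasSort (.pred n 0) (s.eval (termModel Γ) ρ) ∧
        ∀ i, Element.HasSort (.ind 0) ((ts i).eval (termModel Γ) ρ)) ∧
      Provable Γ p (((Element.rename (2 * · + 1) (s.eval (termModel Γ) ρ)).asPred n).atom
        fun i => (Element.rename (2 * · + 1) ((ts i).eval (termModel Γ) ρ)).asTerm) := Iff.rfl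

theorem forces_isV {t : DTerm L} {ρ : SOVar → Element L} {p : (termModel Γ).World} :
    (isV t).Forces (termModel Γ) ρ p ↔
      Provable Γ p .bot ∨ Element.HasSort (.ind 0) (t.eval (termModel Γ) ρ) := Iff.rfl

theorem forces_isU {n : ℕ} {t : DTerm L} {ρ : SOVar → Element L} {p : (termModel Γ).World} :
    (isU n t).Forces (termModel Γ) ρ p ↔
      Provable Γ p .bot ∨ Element.HasSort (.pred n 0) (t.eval (termModel Γ) ρ) := Iff.rfl

theorem forces_sortOf {v : SOVar} {ρ : SOVar → Element L} {p : (termModel Γ).World} :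
    (sortOf v).Forces (termModel Γ) ρ p ↔ Provable Γ p .bot ∨ (ρ v).HasSort v := by
  cases v <;> exact Iff.rfl

theorem eval_dagger {ρ : SOVar → Element L} (hρ : ∀ v, (ρ v).HasSort v) (t : Term L ℕ) :
    t.dagger.eval (termModel Γ) ρ = Sum.inl (t.bind fun x => (ρ (.ind x)).asTerm) := by
  induction t with
  | var x =>
    obtain ⟨t, ht⟩ := hρ (.ind x)
    simp [Term.dagger, Term.eval, Term.bind, ht]
  | app f ts ih =>
    refine congrArg (Sum.inl ∘ Term.app f) (funext fun i => ?_)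
    exact congrArg Element.asTerm (ih i)

theorem Term.rename_bind {ρ : SOVar → Element L} (hρ : ∀ v, (ρ v).HasSort v) (π : ℕ → ℕ)
    (t : Term L ℕ) : (t.bind fun x => (ρ (.ind x)).asTerm).rename π =
      t.bind fun x => ((ρ (.ind x)).rename π).asTerm := by
  induction t with
  | var x =>
    obtain ⟨t, ht⟩ := hρ (.ind x)
    simp [bind, ht, Element.rename]
  | app f ts ih => exact congrArg (app f) (funext ih)

theorem forces_ap_dagger {n : ℕ} {s : DTerm L} {ts : Fin n → Term L ℕ} {ρ : SOVar → Element L}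
    (hρ : ∀ v, (ρ v).HasSort v) (hs : Element.HasSort (.pred n 0) (s.eval (termModel Γ) ρ))
    {p : (termModel Γ).World} :
    (ap n s fun i => (ts i).dagger).Forces (termModel Γ) ρ p ↔
      Provable Γ p (((Element.rename (2 * · + 1) (s.eval (termModel Γ) ρ)).asPred n).atom
        fun i => (ts i).bind fun x => ((ρ (.ind x)).rename (2 * · + 1)).asTerm) := by
  have h : ∀ i, Element.rename (2 * · + 1) ((ts i).dagger.eval (termModel Γ) ρ) =
      .inl ((ts i).bind fun x => ((ρ (.ind x)).rename (2 * · + 1)).asTerm) := by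
    intro i
    rw [eval_dagger hρ, Element.rename, Term.rename_bind hρ]
  rw [forces_ap]
  simp only [h, Element.asTerm_inl]
  constructor
  · rintro (d | ⟨-, d⟩)
    · exact .botE d
    · exact d
  · exact fun d => Or.inr ⟨⟨hs, fun i => ⟨_, eval_dagger hρ _⟩⟩, d⟩

/-- `Γ` may be infinite but is closed, so only the variables of `A` and of the finite set `p` must
be avoided. The index is odd because the fresh variable has to be the renaming of a domain element.
-/
theorem exists_fresh (hΓ : ∀ B ∈ Γ, B.IsSentence) (p : {p : Set (SOFormula L) // p.Finite})
    (A : SOFormula L) (v : SOVar) :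
    ∃ k, v.rename (fun _ => 2 * k + 1) ∉ A.occ ∧
      ∀ B ∈ Γ ∪ p.1, v.rename (fun _ => 2 * k + 1) ∉ B.fv := by
  have inj : Function.Injective fun k : ℕ => v.rename fun _ => 2 * k + 1 := by
    intro a b h
    cases v <;> simpa [SOVar.rename] using h
  have fin : (A.occ ∪ ⋃ B ∈ p.1, B.occ).Finite :=
    A.occ_finite.union (p.2.biUnion fun B _ => B.occ_finite)
  obtain ⟨_, ⟨k, rfl⟩, hk⟩ := (Set.infinite_range_of_injective inj).exists_notMem_finite fin
  simp only [Set.mem_union, Set.mem_iUnion, not_or, not_exists] at hk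
  refine ⟨k, hk.1, ?_⟩
  rintro B (hB | hB)
  · rw [hΓ B hB]
    exact Set.notMem_empty _
  · exact fun h => hk.2 B hB (B.fv_subset_occ h)

/-- The truth lemma. Guards confine the quantifiers to elements of the right sort, introduction and
elimination rules match the clauses of forcing, and density is absorbed by `Provable.of_dense`. -/
theorem forces_dagger (hΓ : ∀ B ∈ Γ, B.IsSentence) (A : SOFormula L) {ρ : SOVar → Element L}
    (hρ : ∀ v, (ρ v).HasSort v) (p : (termModel Γ).World) :
    A.dagger.Forces (termModel Γ) ρ p ↔
      Provable Γ p (A.inst fun v => (ρ v).rename (2 * · + 1)) := by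
  have sorted_update : ∀ {ρ : SOVar → Element L}, (∀ v, (ρ v).HasSort v) → ∀ {v d},
      Element.HasSort v d → ∀ w, (Function.update ρ v d w).HasSort w := by
    intro ρ hρ v d hd w
    by_cases e : w = v
    · subst e; simpa using hd
    · simpa [e] using hρ w
  have inst_eq : ∀ (A : SOFormula L) {ρ : SOVar → Element L}, (∀ v, (ρ v).HasSort v) →
      ∀ (v : SOVar) (d : Element L), d.HasSort v →
      (A.inst (Function.update (fun v => (ρ v).rename (2 * · + 1)) v
        (.ofVar v.double))).FreeForElement v.double (d.rename (2 * · + 1)) ∧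
      (A.inst fun w => (Function.update ρ v d w).rename (2 * · + 1)) =
        (A.inst (Function.update (fun v => (ρ v).rename (2 * · + 1)) v
          (.ofVar v.double))).substElement v.double (d.rename (2 * · + 1)) := by
    intro A ρ hρ v d hd
    have tame : ∀ w, Element.Tame w (Function.update (fun v => (ρ v).rename (2 * · + 1)) v
        (.ofVar v.double) w) :=
      Element.tame_update (fun w => (hρ w).tame_rename) (Element.tame_ofVar_double v)
    refine ⟨SOFormula.inst_freeForElement ?_ d.double_notMem_vars_rename, ?_⟩
    · cases v <;> exact hd.rename _
    · rw [SOFormula.inst_substElement tame (by simp), Function.update_idem]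
      congr 1
      funext w
      by_cases e : w = v
      · subst e; simp
      · simp [e]
  -- `d` is the generic element: its odd renaming is the fresh variable `w`.
  have fresh : ∀ (A : SOFormula L) {ρ : SOVar → Element L}, (∀ v, (ρ v).HasSort v) →
      ∀ (v : SOVar) (p : {p : Set (SOFormula L) // p.Finite}), ∃ w d,
        Element.HasSort v.double (.ofVar w : Element L) ∧ v.double ≠ w ∧
        w ∉ (A.inst (Function.update (fun v => (ρ v).rename (2 * · + 1)) v (.ofVar v.double))).occ ∧
        (∀ B ∈ Γ ∪ p.1, w ∉ B.fv) ∧ Element.HasSort v d ∧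
        d.rename (2 * · + 1) = (.ofVar w : Element L) := by
    intro A ρ hρ v p
    obtain ⟨k, h₁, h₂⟩ := exists_fresh hΓ p
      (A.inst (Function.update (fun v => (ρ v).rename (2 * · + 1)) v (.ofVar v.double))) v
    refine ⟨_, .ofVar (v.rename fun _ => k), ?_, ?_, h₁, h₂, Element.hasSort_ofVar_rename _ _, ?_⟩
    · cases v <;> exact ⟨_, rfl⟩
    · intro e
      cases v <;> simp [SOVar.double, SOVar.rename] at e <;> omega
    · rw [Element.rename_ofVar, SOVar.rename_rename]
      rfl
  induction A generalizing ρ p with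
  | bot =>
    have hs : Element.HasSort (.pred 0 0) (cBot.eval (termModel Γ) ρ) := ⟨.bot, rfl⟩
    have hts : (Fin.elim0 : Fin 0 → DTerm L) = fun i => (Fin.elim0 i : Term L ℕ).dagger :=
      Subsingleton.elim _ _
    rw [SOFormula.dagger, hts, forces_ap_dagger hρ hs]
    change Provable Γ p ((Element.asPred 0 (Sum.inr ⟨0, .bot⟩)).atom _) ↔ _
    rw [Element.asPred_inr]
    rfl
  | rel R ts =>
    have hs : Element.HasSort (.pred _ 0) ((cRel R).eval (termModel Γ) ρ) := ⟨.rel R, rfl⟩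
    rw [SOFormula.dagger, forces_ap_dagger hρ hs]
    change Provable Γ p ((Element.asPred _ (Sum.inr ⟨_, .rel R⟩)).atom _) ↔ _
    rw [Element.asPred_inr]
    rfl
  | pvar n X ts => exact forces_ap_dagger hρ (hρ (.pred n X))
  | and A B ihA ihB =>
    refine (and_congr (ihA hρ p) (ihB hρ p)).trans ⟨fun h => .andI h.1 h.2, fun h => ⟨?_, ?_⟩⟩
    · exact .andE₁ h
    · exact .andE₂ h
  | or A B ihA ihB =>
    simp only [SOFormula.dagger, Formula.Forces, ihA hρ, ihB hρ]
    constructor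
    · refine fun h => Provable.of_dense fun q hq k => h q hq fun r hr d => k r hr ?_
      exact d.elim .orI₁ .orI₂
    · intro h q hq k
      -- Adding either disjunct to `q` gives a world that `k` shows to be absurd.
      refine SOL.orE (Provable.mono hq h) ?_ ?_
      · exact Provable.iff_insert.1 (k _ (Set.subset_insert _ _) (Or.inl Provable.of_insert))
      · exact Provable.iff_insert.1 (k _ (Set.subset_insert _ _) (Or.inr Provable.of_insert))
  | imp A B ihA ihB =>
    simp only [SOFormula.dagger, Formula.Forces, ihA hρ, ihB hρ]
    constructor
    · exact fun h =>
        .impI (Provable.iff_insert.1 (h _ (Set.subset_insert _ _) Provable.of_insert))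
    · exact fun h q hq d => .impE (Provable.mono hq h) d
  | all v A ih =>
    constructor
    · intro h
      obtain ⟨w, d, hs, hne, hocc, hfv, hd, e⟩ := fresh A hρ v p
      refine SOL.allI_fresh hs hne hocc hfv ?_
      have := (ih (sorted_update hρ hd) p).1 (h d p le_rfl (forces_sortOf.2 (Or.inr (by simpa))))
      rwa [(inst_eq A hρ v d hd).2, e] at this
    · intro h d q hq hs
      -- The guard may be forced just because `q` is absurd, and then so is everything else.
      rcases forces_sortOf.1 hs with hs | hs
      · exact Formula.Forces.of_pole hs
      · rw [Function.update_self] at hs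
        refine (ih (sorted_update hρ hs) q).2 ?_
        rw [(inst_eq A hρ v d hs).2]
        exact SOL.allElim (inst_eq A hρ v d hs).1 (Provable.mono hq h)
  | ex v A ih =>
    constructor
    · refine fun h => Provable.of_dense fun q hq k => h q hq ?_
      rintro r hr ⟨d, hs, hA⟩
      rcases forces_sortOf.1 hs with hs | hs
      · exact hs
      · rw [Function.update_self] at hs
        replace hA := (ih (sorted_update hρ hs) r).1 hA
        rw [(inst_eq A hρ v d hs).2] at hA
        exact k r hr (SOL.exIntro (inst_eq A hρ v d hs).1 hA)
    · intro h q hq k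
      obtain ⟨w, d, hs, hne, hocc, hfv, hd, e⟩ := fresh A hρ v q
      refine SOL.exE_fresh hs hne hocc hfv (Set.notMem_empty _) (Provable.mono hq h) ?_
      refine Provable.iff_insert.1 (k _ (Set.subset_insert _ _)
        ⟨d, forces_sortOf.2 (Or.inr (by simpa)), ?_⟩)
      refine (ih (sorted_update hρ hd) _).2 ?_
      rw [(inst_eq A hρ v d hd).2, e]
      exact Provable.of_insert

/-- The given assignment may be ill-sorted; a closed formula does not notice its replacement by
`Element.ofVar`. -/
theorem forces_dagger_of_isSentence (hΓ : ∀ B ∈ Γ, B.IsSentence) {A : SOFormula L}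
    (hA : A.IsSentence) (ρ : SOVar → Element L) (p : (termModel Γ).World) :
    A.dagger.Forces (termModel Γ) ρ p ↔ Provable Γ p (A.rename (2 * ·)) := by
  have h : A.dagger.Forces (termModel Γ) ρ = A.dagger.Forces (termModel Γ) fun v => .ofVar v :=
    Formula.forces_congr fun v hv => by
      rw [SOFormula.fv_dagger, hA] at hv
      exact hv.elim
  rw [h, forces_dagger hΓ A (fun v => by cases v <;> exact ⟨_, rfl⟩), hA.inst]

/-- The sort axioms hold because sorts are disjoint summands of the domain. Comprehension holds by
the truth lemma, since doubling the indices of a comprehension axiom gives another one. -/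
theorem GAxiom.forces (hΓ : ∀ B ∈ Γ, B.IsSentence) {A : DFormula L} (h : GAxiom A)
    (ρ : SOVar → Element L) (p : (termModel Γ).World) : A.Forces (termModel Γ) ρ p := by
  cases h with
  | exV x =>
    exact ForcingModel.Dense.of (fun hpq ⟨d, h⟩ => ⟨d, h.mono hpq⟩)
      ⟨Element.ofVar (.ind 0), forces_isV.2 (Or.inr (by
        simp [Term.eval, Element.ofVar, Element.HasSort]))⟩
  | exU n x =>
    exact ForcingModel.Dense.of (fun hpq ⟨d, h⟩ => ⟨d, h.mono hpq⟩)
      ⟨Element.ofVar (.pred n 0), forces_isU.2 (Or.inr (by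
        simp [Term.eval, Element.ofVar, Element.HasSort]))⟩
  | disjVU n x =>
    intro q _ h r hqr h'
    rcases forces_isV.1 h with h | ⟨t, h⟩
    · exact Provable.mono hqr h
    · rcases forces_isU.1 h' with h' | ⟨T, h'⟩
      · exact h'
      · rw [h] at h'
        cases h'
  | disjUU m n hmn x =>
    intro q _ h r hqr h'
    rcases forces_isU.1 h with h | ⟨t, h⟩
    · exact Provable.mono hqr h
    · rcases forces_isU.1 h' with h' | ⟨T, h'⟩
      · exact h'
      · rw [h] at h'
        exact absurd (Sigma.mk.inj (Sum.inr.inj h')).1 hmn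
  | apSort n x y =>
    intro q _ h
    rw [Formula.forces_conj]
    rcases forces_ap.1 h with h | ⟨⟨h₁, h₂⟩, -⟩
    · exact fun A _ => Formula.Forces.of_pole h
    · intro A hA
      rcases List.mem_cons.1 hA with rfl | hA
      · exact forces_isU.2 (Or.inr h₁)
      · obtain ⟨k, rfl⟩ := (List.mem_ofFn' _ _).1 hA
        exact forces_isV.2 (Or.inr (h₂ k))
  | constV c hc => exact forces_isV.2 (Or.inr ⟨_, rfl⟩)
  | relU R => exact forces_isU.2 (Or.inr ⟨_, rfl⟩)
  | botU => exact forces_isU.2 (Or.inr ⟨_, rfl⟩)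
  | botAp =>
    intro q _ h
    have e := (forces_dagger_of_isSentence hΓ (A := .bot) rfl ρ q).1 h
    exact e
  | funV f x => exact fun q _ _ => forces_isV.2 (Or.inr ⟨_, rfl⟩)
  | compr ψ hψ =>
    rw [forces_dagger_of_isSentence hΓ (SOFormula.fv_of_mem_comprehension hψ)]
    exact .compr (SOFormula.rename_mem_comprehension (fun a b h => by simpa using h) hψ)

theorem SOL.of_dagger (hΓ : ∀ B ∈ Γ, B.IsSentence) {A : SOFormula L} (hA : A.IsSentence)
    (d : FOL (SOFormula.dagger '' Γ ∪ G L) A.dagger) : SOL Γ A := by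
  refine SOL.of_double ?_
  have hΔ : ∀ B ∈ SOFormula.rename (2 * ·) '' Γ, B.IsSentence := by
    rintro _ ⟨B, hB, rfl⟩
    rw [SOFormula.IsSentence, SOFormula.fv_rename (fun a b h => by simpa using h), hΓ B hB,
      Set.image_empty]
  -- The model is built over the doubled theory, because forcing the translation of a sentence means
  -- provability of its doubled copy.
  have := d.sound (M := termModel (SOFormula.rename (2 * ·) '' Γ)) (fun v => .ofVar v)
    ⟨∅, Set.finite_empty⟩ ?_
  · rw [forces_dagger_of_isSentence hΔ hA] at this
    simpa [Provable] using this
  · rintro _ (⟨B, hB, rfl⟩ | ⟨B, hB, hBC⟩)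
    · rw [forces_dagger_of_isSentence hΔ (hΓ B hB)]
      exact .assume (Or.inl ⟨B, hB, rfl⟩)
    · exact hBC.forces (fun ρ => hB.forces hΔ ρ _) _

end TermModel

end VanDalen

theorem theorem6p1 (L : VanDalen.Signature) (Γ : Set (VanDalen.SOFormula L))
    (φ : VanDalen.SOFormula L) (hΓ : ∀ ψ ∈ Γ, ψ.IsSentence) (hφ : φ.IsSentence) :
    VanDalen.SOL Γ φ ↔
      VanDalen.FOL (VanDalen.SOFormula.dagger '' Γ ∪ VanDalen.G L) φ.dagger :=
  ⟨fun h => h.dagger hΓ hφ, VanDalen.SOL.of_dagger hΓ hφ⟩
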